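/- Let $G$ be a finite graph with vertex set $V(G)$ and edge multiset $E(G)$ (loops and multiple edges allowed), let $w:V(G)\to\{1,2,\dots\}$ be a weight function, and put $w(G)=\sum_{v\in V(G)}w(v)$. Work over a field of characteristic $0$. For a coloring $\kappa:V(G)\to\mathbb N$ let $e(\kappa)$ be the number of edges whose endpoints receive the same color (counted with multiplicity, loops included); $\kappa$ is proper if $e(\kappa)=0$. Define $$X_{(G,w)}=\sum_{\kappa\text{ proper}}\ \prod_{v\in V(G)}x_{\kappa(v)}^{w(v)},\qquad XB_{(G,w)}=\sum_{\kappa}(1+t)^{e(\kappa)}\prod_{v\in V(G)}x_{\kappa(v)}^{w(v)},$$ and let $[(1+t)^k]XB_{(G,w)}$ be the coefficient of $(1+t)^k$ in the expansion of $XB_{(G,w)}$ in powers of $1+t$. For a symmetric function $f$, written uniquely as a finite sum $f=\sum_\lambda c_\lambda e_\lambda$ in the basis of elementary symmetric functions, let $\sigma_l(f)$ be the sum of the $c_\lambda$ over the partitions $\lambda$ with exactly $l$ parts. For $A\subseteq E(G)$ let $G/A$ be the graph obtained by contracting every edge of $A$: the edges of $A$ are removed and the vertices in each connected component of $(V(G),A)$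 are identified, all other edges being kept (possibly as loops or parallel edges); $w/A$ gives each new vertex the total weight of the vertices merged into it. For a vertex-weighted graph $(H,u)$ put $$N_l(H,u)=\sum_{\substack{(\gamma,S)\\ \mathrm{swt}(S)=l}}(-1)^{\,l-\mathrm{sink}(\gamma)},$$ summed over all pairs $(\gamma,S)$ where $\gamma$ is an acyclic orientation of $H$ (there is none if $H$ has a loop), $S$ assigns to each sink $v$ of $\gamma$ (a vertex with no outgoing edge) a nonempty subset $S(v)$ of $[u(v)]=\{1,\dots,u(v)\}$, $\mathrm{swt}(S)=\sum_{v\text{ a sink of }\gamma}|S(v)|$, and $\mathrm{sink}(\gamma)$ is the number of sinks of $\gamma$. Then for all integers $k,l\ge 0$ $$\sigma_l\bigl([(1+t)^k]XB_{(G,w)}\bigr)=\sum_{\substack{A\subseteq E(G)\\ |A|=k}}(-1)^{|V(G/A)|+w(G)}\,N_l(G/A,w/A).$$ Moreover, setting $t=-1$ in $XB_{(G,w)}$ gives $X_{(G,w)}$, and for every $l\ge 0$ $$\sigma_l(X_{(G,w)})=(-1)^{|V(G)|+w(G)}\sum_{b,k\ge 0}(-1)^{k-b}\binom kb\sum_{\substack{A\subseteq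 E(G)\\ |A|=k}}N_l(G/A,w/A).$$ -/

import Mathlib

noncomputable section

/-! ### Symmetric functions in countably many variables and the elementary basis -/

namespace SymFun

/-- The elementary symmetric function `e_n` in the variables `x_0, x_1, …`: the sum of all
squarefree monomials of degree `n`. -/
def elem (K : Type*) [Field K] (n : ℕ) : MvPowerSeries ℕ K := by
  classical
  exact fun m => if (∀ i, m i ≤ 1) ∧ m.degree = n then 1 else 0

/-- Integer partitions of arbitrary size. -/
abbrev IntPartition : Type := Σ d : ℕ, Nat.Partition d

/-- The length (number of parts) of an integer partition. -/
def IntPartition.length (p : IntPartition) : ℕ := p.2.parts.card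

/-- `e_lam = e_{lam_1} e_{lam_2} ⋯ e_{lam_r}`. -/
def elemPart (K : Type*) [Field K] (p : IntPartition) : MvPowerSeries ℕ K :=
  (p.2.parts.map (elem K)).prod

/-- `c` is a family of `e`-basis coefficients of `f`, that is, `f = ∑ c_lam e_lam`
(a finite sum). -/
def IsEExpansion {K : Type*} [Field K] (f : MvPowerSeries ℕ K) (c : IntPartition →₀ K) : Prop :=
  f = c.sum fun p a => a • elemPart K p

/-- The `e`-basis coefficients of `f`. A symmetric function has exactly one `e`-expansion; the
value is zero for a power series without any. -/
def eCoeffs {K : Type*} [Field K] (f : MvPowerSeries ℕ K) : IntPartition →₀ K := by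
  classical
  exact if h : ∃ c, IsEExpansion f c then h.choose else 0

/-- `σ_l(f)`: the sum of those `e`-basis coefficients of `f` whose partition has length `l`. -/
def sigma {K : Type*} [Field K] (l : ℕ) (f : MvPowerSeries ℕ K) : K :=
  (eCoeffs f).sum fun p a => if p.length = l then a else 0

/-- `[(1+t)^k] F`: the coefficient of `(1+t)^k` when every coefficient of `F`, a polynomial
in `t`, is expanded in powers of `1 + t = t - (-1)`. -/
def coeffOneAddT {K : Type*} [Field K] (k : ℕ) (F : MvPowerSeries ℕ (Polynomial K)) :
    MvPowerSeries ℕ K :=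
  fun m => (Polynomial.taylor (-1) (MvPowerSeries.coeff m F)).coeff k

end SymFun

/-! ### Vertex-weighted multigraphs -/

namespace Graph

variable {α β : Type*}

/-- `w(G)`, the total weight. -/
def totalWeight (G : Graph α β) (w : α → ℕ) : ℕ := ∑ᶠ v ∈ G.vertexSet, w v

/-- The exponent vector of the monomial `∏_v x_{κ(v)}^{w(v)}` of a coloring `κ`. -/
def colorExponent (G : Graph α β) (w : α → ℕ) (κ : G.vertexSet → ℕ) : ℕ →₀ ℕ :=
  ∑ᶠ v : G.vertexSet, Finsupp.single (κ v) (w v)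

/-- `e(κ)`: the number of edges, with multiplicity and including loops, whose endpoints receive
the same color. -/
def monoEdges (G : Graph α β) (κ : G.vertexSet → ℕ) : ℕ :=
  {e : β | ∃ x y : G.vertexSet, G.IsLink e x y ∧ κ x = κ y}.ncard

/-- A coloring is proper if the endpoints of every edge receive different colors. -/
def IsProperColoring (G : Graph α β) (κ : G.vertexSet → ℕ) : Prop :=
  ∀ (e : β) (x y : G.vertexSet), G.IsLink e x y → κ x ≠ κ y

/-- The chromatic symmetric function: the coefficient of a monomial is the number of proper
colorings with that monomial (finitely many for a finite graph with positive weights). -/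
def chromaticSymm (K : Type*) [Field K] (G : Graph α β) (w : α → ℕ) : MvPowerSeries ℕ K :=
  fun m => ∑ᶠ (κ : G.vertexSet → ℕ) (_ : G.IsProperColoring κ ∧ G.colorExponent w κ = m), 1

/-- The Tutte symmetric function `∑_κ (1+t)^{e(κ)} ∏_v x_{κ(v)}^{w(v)}` over all colorings, with
coefficients in `K[t]`. -/
def tutteSymm (K : Type*) [Field K] (G : Graph α β) (w : α → ℕ) :
    MvPowerSeries ℕ (Polynomial K) :=
  fun m => ∑ᶠ (κ : G.vertexSet → ℕ) (_ : G.colorExponent w κ = m),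
    (1 + Polynomial.X) ^ G.monoEdges κ

/-- The set of vertices that are merged with `v` when the edges in `A` are contracted. -/
def mergeClass (G : Graph α β) (A : Set β) (v : α) : Set α :=
  {u | Relation.ReflTransGen (G.restrict A).Adj v u}

/-- `G/A`: the edges in `A` are removed and the vertices that they connect are identified. All
other edges are kept, also those that become loops or parallel edges. The vertices of `G/A` are
the vertex sets of the components of `(V(G), A)`. -/
def contract (G : Graph α β) (A : Set β) : Graph (Set α) β :=
  (G.deleteEdges A).map (G.mergeClass A)

/-- `w/A`: the weight of a vertex of `G/A` is the sum of the weights of the vertices of `G` that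
were merged into it. -/
def contractWeight (w : α → ℕ) (C : Set α) : ℕ := ∑ᶠ v ∈ C, w v

/-- Acyclic orientations: every edge `e` is given a direction, `γ e = (tail, head)`, so that there
is no directed cycle (in particular, there is none if `G` has a loop). -/
def AcyclicOrientation (G : Graph α β) : Type _ :=
  {γ : G.edgeSet → G.vertexSet × G.vertexSet //
    (∀ e : G.edgeSet, G.IsLink e (γ e).1 (γ e).2) ∧
    ∀ v, ¬ Relation.TransGen (fun x y => ∃ e, γ e = (x, y)) v v}

/-- The sinks: the vertices without an outgoing edge. -/
def AcyclicOrientation.sinks {G : Graph α β} (γ : G.AcyclicOrientation) : Set G.vertexSet :=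
  {v | ∀ e, (γ.1 e).1 ≠ v}

/-- A map `S` that assigns to each sink `v` a nonempty subset of a set of `w v` elements. -/
def AcyclicOrientation.SinkMap {G : Graph α β} (γ : G.AcyclicOrientation) (w : α → ℕ) : Type _ :=
  (v : γ.sinks) → {T : Finset (Fin (w v.1)) // T.Nonempty}

/-- `swt(S) = ∑ |S(v)|` over the sinks `v`. -/
def AcyclicOrientation.swt {G : Graph α β} {γ : G.AcyclicOrientation} {w : α → ℕ}
    (S : γ.SinkMap w) : ℕ :=
  ∑ᶠ v : γ.sinks, (S v).1.card

/-- `∑ (-1)^{l - sink(γ)}` over the pairs `(γ, S)` with `swt(S) = l`. Since each `S(v)` is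
nonempty, `sink(γ) ≤ l` for all of these. -/
def sinkCount (G : Graph α β) (w : α → ℕ) (l : ℕ) : ℤ :=
  ∑ᶠ (p : Σ γ : G.AcyclicOrientation, γ.SinkMap w) (_ : AcyclicOrientation.swt p.2 = l),
    (-1) ^ (l - p.1.sinks.ncard)

end Graph

end

/-! For a set `U` of vertices let `f U` be the chromatic function of the graph induced on `U`. Such
set functions multiply by `conv`, and restricting to the sets that contain `v` (`pt v`) is a
derivation. A single color `x` gives `twist u x (stab adj)`, and `n` colors give the convolution of
`n` such factors. The logarithmic derivative of a one-color factor at a set `B` is `x ^ wt u B`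
times an integer `kernel adj v B` that does not depend on `x`. Logarithmic derivatives add, so for
several colors `x ^ k` is replaced by the power sum `p_k` (`Rec.colorSum`). The resulting recursion
determines `f` (`Rec.unique`). Hence the chromatic function is a polynomial in power sums, thus in
the `e_j`, and a homomorphism acts on it by replacing the values of the `p_k`.

The number `σ_l` is the coefficient of `y^l` under the homomorphism `e_j ↦ y` for all `j ≥ 1`. As `1
+ ∑ y t^j = (1 - (1-y)t) / (1-t)`, this sends `p_k` to `(-(1-y))^k - (-1)^k`, the power sums of one
variable `-(1-y)` and one cancelled variable `-1`. The image is therefore a one-color factor at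
`-(1-y)` convolved with the inverse of the one at `-1` (`eq_conv_of_rec`). The inverse of `stab` is
the signed count of acyclic orientations (`conv_stab_sgnAcyc`), and the product becomes, up to sign,
the sum over acyclic orientations of `∏ (1 - (1-y)^{w(v)})` over the sinks (`conv_twist_eq`).
Expanding every factor over the nonempty subsets of `[w(v)]` yields `N_l`.

Colorings of `G` whose set of monochromatic edges is exactly `A` are the proper colorings of `G/A`,
so the coefficient of `(1+t)^k` is the sum of the chromatic functions of `G/A` over `|A| = k`.
Setting `t = -1` selects `k = 0`, and the alternating binomial sum in the last formula does the
same. -/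

noncomputable section

/-! ### Convolution of set functions and the recursion driven by power sums -/

namespace SetConv

open Finset

variable {V R : Type*} [DecidableEq V] [CommRing R]

/-- The convolution product of two functions on finite sets. -/
def conv (f g : Finset V → R) (U : Finset V) : R := ∑ T ∈ U.powerset, f T * g (U \ T)

/-- The neutral element of the convolution product. -/
def delta (U : Finset V) : R := if U = ∅ then 1 else 0

/-- The restriction of a set function to the sets that contain `v`. -/
def pt (v : V) (f : Finset V → R) (U : Finset V) : R := if v ∈ U then f U else 0

/-- The total weight of a finite set. -/
def wt (u : V → ℕ) (T : Finset V) : ℕ := ∑ v ∈ T, u v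

/-- The set function scaled by the powers `x ^ wt u T`. -/
def twist (u : V → ℕ) (x : R) (f : Finset V → R) (T : Finset V) : R := x ^ wt u T * f T

theorem conv_comm (f g : Finset V → R) : conv f g = conv g f := by
  funext U
  refine Finset.sum_bij' (fun T _ => U \ T) (fun T _ => U \ T) ?_ ?_ ?_ ?_ ?_
  · intro T _; simp
  · intro T _; simp
  · intro T hT; simpa using hT
  · intro T hT; simpa using hT
  · intro T hT
    rw [Finset.sdiff_sdiff_eq_self (by simpa using hT), mul_comm]

theorem conv_assoc (f g h : Finset V → R) : conv (conv f g) h = conv f (conv g h) := by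
  funext U
  simp only [conv, Finset.sum_mul, Finset.mul_sum]
  rw [Finset.sum_sigma', Finset.sum_sigma']
  refine Finset.sum_bij' (fun p _ => ⟨p.2, p.1 \ p.2⟩) (fun p _ => ⟨p.1 ∪ p.2, p.1⟩) ?_ ?_ ?_ ?_ ?_
  · rintro ⟨W, T⟩ hp
    simp only [mem_sigma, mem_powerset] at hp ⊢
    exact ⟨hp.2.trans hp.1, Finset.sdiff_subset_sdiff hp.1 le_rfl⟩
  · rintro ⟨T, S⟩ hp
    simp only [mem_sigma, mem_powerset] at hp ⊢
    exact ⟨Finset.union_subset hp.1 (hp.2.trans Finset.sdiff_subset), Finset.subset_union_left⟩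
  · rintro ⟨W, T⟩ hp
    simp only [mem_sigma, mem_powerset] at hp ⊢
    rw [Finset.union_sdiff_of_subset hp.2]
  · rintro ⟨T, S⟩ hp
    simp only [mem_sigma, mem_powerset] at hp ⊢
    have : (T ∪ S) \ T = S := by
      rw [Finset.union_sdiff_left, Finset.sdiff_eq_self_iff_disjoint]
      exact (Finset.subset_sdiff.1 hp.2).2
    rw [this]
  · rintro ⟨W, T⟩ hp
    simp only [mem_sigma, mem_powerset] at hp ⊢
    have : (U \ T) \ (W \ T) = U \ W := by
      ext a
      have := @hp.2 a
      simp only [mem_sdiff]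
      tauto
    rw [this, mul_assoc]

theorem delta_conv (f : Finset V → R) : conv delta f = f := by
  funext U
  rw [conv, Finset.sum_eq_single ∅] <;> simp +contextual [delta]

theorem conv_delta (f : Finset V → R) : conv f delta = f := by
  rw [conv_comm, delta_conv]

theorem add_conv (f g h : Finset V → R) : conv (f + g) h = conv f h + conv g h := by
  funext U
  simp [conv, add_mul, Finset.sum_add_distrib]

theorem conv_empty (f g : Finset V → R) : conv f g ∅ = f ∅ * g ∅ := by
  simp [conv]

/-- Leibniz rule: if `v ∈ U`, then `v` lies in exactly one of `T` and `U \ T`. -/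
theorem pt_conv (v : V) (f g : Finset V → R) :
    pt v (conv f g) = conv (pt v f) g + conv f (pt v g) := by
  funext U
  simp only [pt, conv, Pi.add_apply]
  rw [← Finset.sum_add_distrib]
  split_ifs with hv
  · refine Finset.sum_congr rfl fun T _ => ?_
    by_cases h : v ∈ T <;> simp [h, hv]
  · refine (Finset.sum_eq_zero fun T hT => ?_).symm
    have : v ∉ T := fun h => hv (mem_powerset.1 hT h)
    simp [hv, this]

theorem wt_add {u : V → ℕ} {T U : Finset V} (h : T ⊆ U) : wt u T + wt u (U \ T) = wt u U := by
  rw [wt, wt, wt, add_comm, Finset.sum_sdiff h]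

theorem twist_conv (u : V → ℕ) (x : R) (f g : Finset V → R) :
    conv (twist u x f) (twist u x g) = twist u x (conv f g) := by
  funext U
  simp only [conv, twist, Finset.mul_sum]
  refine Finset.sum_congr rfl fun T hT => ?_
  rw [← wt_add (mem_powerset.1 hT), pow_add]
  ring

theorem pt_twist (v : V) (u : V → ℕ) (x : R) (f : Finset V → R) :
    pt v (twist u x f) = twist u x (pt v f) := by
  funext U
  simp [pt, twist]

theorem map_conv {S : Type*} [CommRing S] (φ : R →+* S) (f g : Finset V → R) (U : Finset V) :
    φ (conv f g U) = conv (fun T => φ (f T)) (fun T => φ (g T)) U := by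
  simp [conv]

/-- The set function `f` satisfies the recursion with kernel `c` for the power sums `p`. -/
def Rec (c : V → Finset V → ℤ) (u : V → ℕ) (p : ℕ → R) (f : Finset V → R) : Prop :=
  f ∅ = 1 ∧ ∀ v, pt v f = conv (fun B => (c v B : R) * p (wt u B)) f

variable {c : V → Finset V → ℤ} {u : V → ℕ}

/-- By the Leibniz rule logarithmic derivatives add, and the kernel is the same for both factors.
This allows adjoining colors one at a time. -/
theorem Rec.conv {p q : ℕ → R} {f g : Finset V → R} (hf : Rec c u p f) (hg : Rec c u q g) :
    Rec c u (p + q) (conv f g) := by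
  refine ⟨by rw [conv_empty, hf.1, hg.1, one_mul], fun v => ?_⟩
  have : (fun B => (c v B : R) * (p + q) (wt u B)) =
      (fun B => (c v B : R) * p (wt u B)) + fun B => (c v B : R) * q (wt u B) := by
    funext B
    simp [mul_add]
  rw [pt_conv, hf.2, hg.2, this, add_conv, conv_assoc, conv_comm f (SetConv.conv _ g), conv_assoc _ g f,
    conv_comm g f]

theorem Rec.delta : Rec c u (0 : ℕ → R) delta := by
  refine ⟨by simp [SetConv.delta], fun v => ?_⟩
  funext U
  rw [conv_delta]
  by_cases h : U = ∅ <;> simp [pt, SetConv.delta, h]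

theorem Rec.map {S : Type*} [CommRing S] (φ : R →+* S) {p : ℕ → R} {f : Finset V → R}
    (hf : Rec c u p f) : Rec c u (fun n => φ (p n)) (fun U => φ (f U)) := by
  refine ⟨by simp [hf.1], fun v => ?_⟩
  funext U
  have := congrArg φ (congrFun (hf.2 v) U)
  rw [map_conv] at this
  simpa [pt, apply_ite φ] using this

theorem conv_congr_right {f g g' : Finset V → R} {U : Finset V} (h0 : f ∅ = 0)
    (h : ∀ T, T ⊂ U → g T = g' T) : conv f g U = conv f g' U := by
  refine Finset.sum_congr rfl fun T hT => ?_
  rcases T.eq_empty_or_nonempty with rfl | hne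
  · simp [h0]
  · rw [h _ (Finset.sdiff_ssubset (mem_powerset.1 hT) hne)]

/-- Choosing `v ∈ U`, the recursion expresses the value at `U` through values at proper subsets,
because the term of `B = ∅` vanishes. For the same reason `p` and `q` need only agree at weights of
nonempty sets. -/
theorem Rec.unique (hc : ∀ v, c v ∅ = 0) {p q : ℕ → R} (hpq : ∀ U, U.Nonempty → p (wt u U) = q (wt u U))
    {f g : Finset V → R} (hf : Rec c u p f) (hg : Rec c u q g) : f = g := by
  funext U
  induction U using Finset.strongInduction with
  | H U ih =>
    rcases U.eq_empty_or_nonempty with rfl | ⟨v, hv⟩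
    · rw [hf.1, hg.1]
    · have h1 := congrFun (hf.2 v) U
      have h2 := congrFun (hg.2 v) U
      simp only [pt, hv, if_true] at h1 h2
      rw [h1, h2, conv_congr_right (by simp [hc]) ih]
      refine Finset.sum_congr rfl fun T _ => ?_
      rcases T.eq_empty_or_nonempty with rfl | hne
      · simp [hc]
      · simp only [hpq T hne]

/-- A solution of the recursion that picks the vertex by choice. -/
def solve (c : V → Finset V → ℤ) (u : V → ℕ) (p : ℕ → R) (U : Finset V) : R :=
  if h : U.Nonempty then
    ∑ B ∈ (U.powerset.filter fun B => B.Nonempty).attach,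
      (c h.choose B : R) * p (wt u B) * solve c u p (U \ B)
  else 1
termination_by U.card
decreasing_by
  have h := B.2
  simp only [mem_filter, mem_powerset] at h
  exact Finset.card_lt_card (Finset.sdiff_ssubset h.1 h.2)

theorem solve_empty (p : ℕ → R) : solve c u p ∅ = 1 := by
  rw [solve]
  simp

theorem solve_eq (hc : ∀ v, c v ∅ = 0) (p : ℕ → R) {U : Finset V} (h : U.Nonempty) :
    ∃ v ∈ U, solve c u p U = conv (fun B => (c v B : R) * p (wt u B)) (solve c u p) U := by
  refine ⟨h.choose, h.choose_spec, ?_⟩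
  rw [solve, dif_pos h, Finset.sum_attach (U.powerset.filter fun B => B.Nonempty)
    (fun B => (c h.choose B : R) * p (wt u B) * solve c u p (U \ B)), Finset.sum_filter, conv]
  refine Finset.sum_congr rfl fun B _ => ?_
  split_ifs with hB
  · rfl
  · simp [Finset.not_nonempty_iff_eq_empty.1 hB, hc]

/-- `solve` is only known to obey the recursion at one chosen vertex of each set. This suffices for
comparison with a `g` that obeys it at every vertex. -/
theorem map_solve {S : Type*} [CommRing S] (φ : R →+* S) (hc : ∀ v, c v ∅ = 0) {p : ℕ → R}
    {q : ℕ → S} (hpq : ∀ U, U.Nonempty → φ (p (wt u U)) = q (wt u U)) {g : Finset V → S}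
    (hg : Rec c u q g) (U : Finset V) : φ (solve c u p U) = g U := by
  induction U using Finset.strongInduction with
  | H U ih =>
    rcases U.eq_empty_or_nonempty with rfl | hU
    · rw [hg.1, solve_empty, map_one]
    · obtain ⟨v, hv, h1⟩ := solve_eq hc p hU
      have h2 := congrFun (hg.2 v) U
      simp only [pt, hv, if_true] at h2
      rw [h1, h2, map_conv, conv_congr_right (by simp [hc]) ih]
      refine Finset.sum_congr rfl fun T _ => ?_
      rcases T.eq_empty_or_nonempty with rfl | hne
      · simp [hc]
      · simp only [map_mul, map_intCast, hpq T hne]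

end SetConv

/-! ### Stable sets, acyclic orientations and colorings as set functions -/

namespace SetConv

open Finset
open scoped Classical

variable {V R : Type*}

theorem exists_start {r : V → V → Prop} {x y : V} (h : Relation.TransGen r x y) : ∃ z, r x z := by
  induction h with
  | single h => exact ⟨_, h⟩
  | tail _ _ ih => exact ih

/-- No step starts in `T`, so a path that ends outside `T` never meets `T`. -/
theorem transGen_restrict {r r' : V → V → Prop} {T : Finset V} (hT : ∀ x ∈ T, ∀ y, ¬ r x y)
    (h' : ∀ x y, r x y → y ∉ T → r' x y) {x y : V} (h : Relation.TransGen r x y) (hy : y ∉ T) :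
    Relation.TransGen r' x y := by
  induction h with
  | single h => exact .single (h' _ _ h hy)
  | tail _ h ih => exact .tail (ih fun hb => hT _ hb _ h) (h' _ _ h hy)

variable [Fintype V] [CommRing R]


/-- The indicator function of the stable sets of a relation. -/
def stab (adj : V → V → Prop) (T : Finset V) : R :=
  if ∀ x ∈ T, ∀ y ∈ T, ¬ adj x y then 1 else 0

/-- The acyclic orientations of the restriction of a relation to a finite set. -/
def acyc (adj : V → V → Prop) (U : Finset V) : Finset (V → V → Prop) :=
  univ.filter fun r => (∀ x y, r x y → x ∈ U ∧ y ∈ U ∧ adj x y) ∧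
    (∀ x ∈ U, ∀ y ∈ U, adj x y → r x y ∨ r y x) ∧ ∀ v, ¬ Relation.TransGen r v v

/-- The sinks of a relation in a finite set. -/
def sinks (U : Finset V) (r : V → V → Prop) : Finset V := U.filter fun v => ∀ y, ¬ r v y

theorem mem_acyc {adj : V → V → Prop} {U : Finset V} {r : V → V → Prop} :
    r ∈ acyc adj U ↔ (∀ x y, r x y → x ∈ U ∧ y ∈ U ∧ adj x y) ∧
    (∀ x ∈ U, ∀ y ∈ U, adj x y → r x y ∨ r y x) ∧ ∀ v, ¬ Relation.TransGen r v v := by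
  simp [acyc]

theorem mem_sinks {U : Finset V} {r : V → V → Prop} {v : V} :
    v ∈ sinks U r ↔ v ∈ U ∧ ∀ y, ¬ r v y := by
  simp [sinks]

theorem stable_of_subset_sinks {adj : V → V → Prop} {U T : Finset V} {r : V → V → Prop}
    (hr : r ∈ acyc adj U) (hT : T ⊆ sinks U r) : ∀ x ∈ T, ∀ y ∈ T, ¬ adj x y := by
  intro x hx y hy h
  have hx' := mem_sinks.1 (hT hx)
  have hy' := mem_sinks.1 (hT hy)
  rcases (mem_acyc.1 hr).2.1 x hx'.1 y hy'.1 h with h | h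
  · exact hx'.2 _ h
  · exact hy'.2 _ h

/-- Deleting `T` is inverse to directing every edge between `U \ T` and `T` into `T`. No cycle can
pass through `T`, since its vertices have no outgoing edges. -/
theorem card_acyc_filter {adj : V → V → Prop} (hadj : ∀ x y, adj x y → adj y x) {U T : Finset V}
    (hTU : T ⊆ U) (hT : ∀ x ∈ T, ∀ y ∈ T, ¬ adj x y) :
    ((acyc adj U).filter fun r => T ⊆ sinks U r).card = (acyc adj (U \ T)).card := by
  refine Finset.card_bij' (fun r _ x y => r x y ∧ y ∉ T)
    (fun r _ x y => r x y ∨ (x ∈ U \ T ∧ y ∈ T ∧ adj x y)) ?_ ?_ ?_ ?_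
  · intro r hr
    obtain ⟨hr, hs⟩ := mem_filter.1 hr
    obtain ⟨h1, h2, h3⟩ := mem_acyc.1 hr
    have hs' : ∀ x ∈ T, ∀ y, ¬ r x y := fun x hx => (mem_sinks.1 (hs hx)).2
    refine mem_acyc.2 ⟨?_, ?_, ?_⟩
    · rintro x y ⟨h, hy⟩
      obtain ⟨a, b, c⟩ := h1 x y h
      exact ⟨mem_sdiff.2 ⟨a, fun hx => hs' x hx y h⟩, mem_sdiff.2 ⟨b, hy⟩, c⟩
    · intro x hx y hy h
      rw [mem_sdiff] at hx hy
      exact (h2 x hx.1 y hy.1 h).imp (fun h => ⟨h, hy.2⟩) (fun h => ⟨h, hx.2⟩)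
    · intro v hv
      exact h3 v (transGen_restrict (T := ∅) (by simp) (fun _ _ h _ => h.1) hv (by simp))
  · intro r hr
    obtain ⟨h1, h2, h3⟩ := mem_acyc.1 hr
    have hs : ∀ x ∈ T, ∀ y, ¬ (r x y ∨ (x ∈ U \ T ∧ y ∈ T ∧ adj x y)) := by
      rintro x hx y (h | h)
      · exact (mem_sdiff.1 (h1 x y h).1).2 hx
      · exact (mem_sdiff.1 h.1).2 hx
    refine mem_filter.2 ⟨mem_acyc.2 ⟨?_, ?_, ?_⟩, fun x hx => mem_sinks.2 ⟨hTU hx, hs x hx⟩⟩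
    · rintro x y (h | ⟨hx, hy, h⟩)
      · obtain ⟨a, b, c⟩ := h1 x y h
        exact ⟨(mem_sdiff.1 a).1, (mem_sdiff.1 b).1, c⟩
      · exact ⟨(mem_sdiff.1 hx).1, hTU hy, h⟩
    · intro x hx y hy h
      by_cases hxT : x ∈ T
      · by_cases hyT : y ∈ T
        · exact (hT x hxT y hyT h).elim
        · exact .inr (.inr ⟨mem_sdiff.2 ⟨hy, hyT⟩, hxT, hadj _ _ h⟩)
      · by_cases hyT : y ∈ T
        · exact .inl (.inr ⟨mem_sdiff.2 ⟨hx, hxT⟩, hyT, h⟩)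
        · exact (h2 x (mem_sdiff.2 ⟨hx, hxT⟩) y (mem_sdiff.2 ⟨hy, hyT⟩) h).imp .inl .inl
    · intro v hv
      have hvT : v ∉ T := fun h => by
        obtain ⟨z, hz⟩ := exists_start hv
        exact hs v h z hz
      refine h3 v (transGen_restrict hs ?_ hv hvT)
      rintro x y (h | h) hy
      · exact h
      · exact (hy h.2.1).elim
  · intro r hr
    obtain ⟨hr, hs⟩ := mem_filter.1 hr
    obtain ⟨h1, h2, h3⟩ := mem_acyc.1 hr
    have hs' : ∀ x ∈ T, ∀ y, ¬ r x y := fun x hx => (mem_sinks.1 (hs hx)).2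
    funext x y
    refine propext ⟨?_, fun h => ?_⟩
    · rintro (h | ⟨hx, hy, h⟩)
      · exact h.1
      · exact (h2 x (mem_sdiff.1 hx).1 y (hTU hy) h).resolve_right (hs' y hy x)
    · obtain ⟨a, b, c⟩ := h1 x y h
      by_cases hy : y ∈ T
      · exact .inr ⟨mem_sdiff.2 ⟨a, fun hx => hs' x hx y h⟩, hy, c⟩
      · exact .inl ⟨h, hy⟩
  · intro r hr
    obtain ⟨h1, h2, h3⟩ := mem_acyc.1 hr
    funext x y
    refine propext ⟨?_, fun h => ⟨.inl h, (mem_sdiff.1 (h1 x y h).2.1).2⟩⟩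
    rintro ⟨h | h, hy⟩
    · exact h
    · exact (hy h.2.1).elim

/-- Expanding a product over the sinks as a convolution. -/
theorem sum_acyc_prod_sinks {adj : V → V → Prop} (hadj : ∀ x y, adj x y → adj y x) (g : V → R)
    (U : Finset V) : ∑ r ∈ acyc adj U, ∏ v ∈ sinks U r, (1 + g v) =
      conv (fun T => stab adj T * ∏ v ∈ T, g v) (fun T => ((acyc adj T).card : R)) U := by
  have h1 : ∀ r, ∏ v ∈ sinks U r, (1 + g v) =
      ∑ T ∈ U.powerset, if T ⊆ sinks U r then ∏ v ∈ T, g v else 0 := by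
    intro r
    rw [Finset.prod_one_add, ← Finset.sum_filter]
    refine Finset.sum_congr ?_ fun _ _ => rfl
    ext T
    simp only [mem_powerset, mem_filter]
    exact ⟨fun h => ⟨h.trans (Finset.filter_subset _ _), h⟩, fun h => h.2⟩
  simp only [h1]
  rw [Finset.sum_comm, conv]
  refine Finset.sum_congr rfl fun T hT => ?_
  rw [← Finset.sum_filter, Finset.sum_const, nsmul_eq_mul, stab]
  split_ifs with hs
  · rw [card_acyc_filter hadj (mem_powerset.1 hT) hs, one_mul, mul_comm]
  · rw [Finset.filter_eq_empty_iff.2]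
    · simp
    · intro r hr h
      exact hs (stable_of_subset_sinks hr h)

theorem sinks_nonempty {adj : V → V → Prop} {U : Finset V} {r : V → V → Prop}
    (hr : r ∈ acyc adj U) (hU : U.Nonempty) : (sinks U r).Nonempty := by
  obtain ⟨h1, _, h3⟩ := mem_acyc.1 hr
  let _ : IsTrans V (Relation.TransGen r) := ⟨fun _ _ _ => Relation.TransGen.trans⟩
  let _ : Std.Irrefl (Relation.TransGen r) := ⟨h3⟩
  have hwf : WellFounded (Function.swap (Relation.TransGen r)) :=
    Finite.wellFounded_of_trans_of_irrefl _
  obtain ⟨m, hm, hmin⟩ := hwf.has_min (U : Set V) hU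
  exact ⟨m, mem_sinks.2 ⟨hm, fun y hy => hmin y (h1 _ _ hy).2.1 (.single hy)⟩⟩

/-- The signed number of acyclic orientations. -/
def sgnAcyc (adj : V → V → Prop) (T : Finset V) : R := (-1) ^ T.card * ((acyc adj T).card : R)

/-- With `g = -1` in `sum_acyc_prod_sinks` every sink contributes the factor `0`, and an acyclic
orientation of a nonempty set has a sink. Only `U = ∅` survives. -/
theorem conv_stab_sgnAcyc {adj : V → V → Prop} (hadj : ∀ x y, adj x y → adj y x) :
    conv (stab adj) (sgnAcyc adj) = (delta : Finset V → R) := by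
  funext U
  have h := sum_acyc_prod_sinks hadj (fun _ => (-1 : R)) U
  have h2 : conv (fun T => stab adj T * ∏ v ∈ T, (-1 : R)) (fun T => ((acyc adj T).card : R)) U =
      (-1) ^ U.card * conv (stab adj) (sgnAcyc adj) U := by
    simp only [conv, sgnAcyc, Finset.prod_const, Finset.mul_sum]
    refine Finset.sum_congr rfl fun T hT => ?_
    rw [← Finset.card_sdiff_add_card_eq_card (mem_powerset.1 hT), pow_add]
    have : ((-1 : R) ^ (U \ T).card) * (-1) ^ (U \ T).card = 1 := by
      rw [← mul_pow]; simp
    linear_combination (-(stab adj T * (-1) ^ T.card * ((acyc adj (U \ T)).card : R))) * this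
  rw [h2] at h
  rcases U.eq_empty_or_nonempty with rfl | hU
  · simp only [card_empty, pow_zero, one_mul] at h
    rw [← h]
    have : acyc adj (∅ : Finset V) = {fun _ _ => False} := by
      ext r
      simp only [mem_acyc, mem_singleton]
      constructor
      · rintro ⟨h, -⟩
        funext x y
        simpa using h x y
      · rintro rfl
        refine ⟨by simp, by simp, fun v hv => ?_⟩
        obtain ⟨z, hz⟩ := exists_start hv
        exact hz
    simp [this, delta, sinks]
  · have : ∑ r ∈ acyc adj U, ∏ v ∈ sinks U r, (1 + (-1 : R)) = 0 := by
      refine Finset.sum_eq_zero fun r hr => ?_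
      obtain ⟨v, hv⟩ := sinks_nonempty hr hU
      exact Finset.prod_eq_zero hv (by simp)
    rw [this] at h
    have h4 : ((-1 : R) ^ U.card) * (-1) ^ U.card = 1 := by
      rw [← mul_pow]; simp
    have h5 : conv (stab adj) (sgnAcyc adj) U = (0 : R) := by
      linear_combination (-(conv (stab adj) (sgnAcyc adj) U)) * h4 - ((-1 : R) ^ U.card) * h
    rw [h5]
    simp [delta, hU.ne_empty]

/-- The kernel of the recursion of the chromatic symmetric functions. -/
def kernel (adj : V → V → Prop) (v : V) : Finset V → ℤ := conv (pt v (stab adj)) (sgnAcyc adj)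

theorem kernel_empty (adj : V → V → Prop) (v : V) : kernel adj v ∅ = 0 := by
  simp [kernel, conv_empty, pt]

theorem cast_stab (adj : V → V → Prop) (T : Finset V) : ((stab adj T : ℤ) : R) = stab adj T := by
  simp only [stab]
  split_ifs <;> simp

/-- The kernel is `pt v (stab adj)` times the inverse of `stab adj`. It is an integer function, so
one kernel serves all rings. -/
theorem pt_stab {adj : V → V → Prop} (hadj : ∀ x y, adj x y → adj y x) (v : V) :
    pt v (stab adj) = conv (fun B => (kernel adj v B : R)) (stab adj) := by
  have h : conv (kernel adj v) (stab adj) = pt v (stab adj) := by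
    rw [kernel, conv_assoc, conv_comm (sgnAcyc adj), conv_stab_sgnAcyc hadj, conv_delta]
  funext U
  have h2 := congrArg (Int.castRingHom R) (congrFun h U)
  rw [map_conv] at h2
  simp only [eq_intCast, cast_stab] at h2
  rw [h2]
  simp [pt, apply_ite (Int.cast : ℤ → R), cast_stab]

/-- The case of one color: scaling by `x ^ wt u T` is compatible with `conv` and with `pt v`, so it
carries `pt_stab` over. -/
theorem Rec.twist_stab {adj : V → V → Prop} (hadj : ∀ x y, adj x y → adj y x) (u : V → ℕ) (x : R) :
    Rec (kernel adj) u (fun n => x ^ n) (twist u x (stab adj)) := by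
  refine ⟨by simp [twist, wt, stab], fun v => ?_⟩
  have : (fun B => (kernel adj v B : R) * x ^ wt u B) =
      twist u x (fun B => (kernel adj v B : R)) := by
    funext B
    rw [twist, mul_comm]
  rw [this, twist_conv, pt_twist, pt_stab hadj]

/-- The generating function of the proper colorings of the restriction of a relation to a finite
set with colors less than `n`. -/
def colorSum (adj : V → V → Prop) (u : V → ℕ) (x : ℕ → R) (n : ℕ) (U : Finset V) : R :=
  ∑ κ ∈ (Fintype.piFinset fun v => if v ∈ U then range n else {n}).filter
    (fun κ => ∀ a ∈ U, ∀ b ∈ U, adj a b → κ a ≠ κ b), ∏ v ∈ U, x (κ v) ^ u v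

theorem colorSum_zero (adj : V → V → Prop) (u : V → ℕ) (x : ℕ → R) :
    colorSum adj u x 0 = delta := by
  funext U
  rcases U.eq_empty_or_nonempty with rfl | ⟨v, hv⟩
  · simp [colorSum, delta]
  · rw [colorSum, delta, if_neg (Finset.ne_empty_of_mem hv)]
    refine Finset.sum_eq_zero fun κ hκ => ?_
    have := Fintype.mem_piFinset.1 (mem_filter.1 hκ).1 v
    simp [hv] at this

theorem colorSum_succ (adj : V → V → Prop) (u : V → ℕ) (x : ℕ → R) (n : ℕ) :
    colorSum adj u x (n + 1) = conv (twist u (x n) (stab adj)) (colorSum adj u x n) := by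
  funext U
  simp only [conv, colorSum, Finset.mul_sum]
  rw [Finset.sum_sigma', ← Finset.sum_filter_of_ne (s := Finset.sigma _ _)
    (p := fun q => ∀ x ∈ q.1, ∀ y ∈ q.1, ¬ adj x y)]
  swap
  · rintro ⟨T, κ⟩ _ h
    by_contra h2
    exact h (by simp [twist, stab, h2])
  -- `T` is the class of the last color `n`. Vertices outside the colored set carry a dummy value,
  -- `n + 1` on the left and `n` on the right; `min (κ v) n` lowers the former and leaves the color
  -- class `T` at the new dummy value.
  refine Finset.sum_bij' (fun κ _ => ⟨U.filter fun v => κ v = n, fun v => min (κ v) n⟩)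
    (fun q _ v => if v ∈ U then q.2 v else n + 1) ?_ ?_ ?_ ?_ ?_
  · intro κ hκ
    obtain ⟨h1, h2⟩ := mem_filter.1 hκ
    rw [Fintype.mem_piFinset] at h1
    simp only [mem_filter, mem_sigma, mem_powerset, Fintype.mem_piFinset]
    refine ⟨⟨Finset.filter_subset _ _, fun v => ?_, ?_⟩, ?_⟩
    · have := h1 v
      by_cases hv : v ∈ U <;> by_cases hn : κ v = n <;> simp [hv, hn] at this ⊢ <;> omega
    · intro a ha b hb hab
      simp only [mem_sdiff, mem_filter, not_and] at ha hb
      have ha' := h1 a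
      have hb' := h1 b
      simp only [ha.1, hb.1, if_true, mem_range] at ha' hb'
      have := h2 a ha.1 b hb.1 hab
      have := ha.2 ha.1
      have := hb.2 hb.1
      omega
    · intro a ha b hb hab
      exact h2 a ha.1 b hb.1 hab (ha.2.trans hb.2.symm)
  · rintro ⟨T, κ⟩ hq
    simp only [mem_filter, mem_sigma, mem_powerset, Fintype.mem_piFinset] at hq ⊢
    obtain ⟨⟨hT, h1, h2⟩, h3⟩ := hq
    refine ⟨fun v => ?_, ?_⟩
    · have := h1 v
      by_cases hv : v ∈ U <;> by_cases hvT : v ∈ T <;> simp [hv, hvT] at this ⊢ <;> omega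
    · intro a ha b hb hab
      have ha' := h1 a
      have hb' := h1 b
      simp only [ha, hb, if_true]
      by_cases haT : a ∈ T <;> by_cases hbT : b ∈ T <;> simp [ha, hb, haT, hbT] at ha' hb'
      · exact (h3 a haT b hbT hab).elim
      · omega
      · omega
      · exact h2 a (by simp [ha, haT]) b (by simp [hb, hbT]) hab
  · intro κ hκ
    obtain ⟨h1, h2⟩ := mem_filter.1 hκ
    rw [Fintype.mem_piFinset] at h1
    funext v
    have := h1 v
    by_cases hv : v ∈ U <;> simp [hv] at this ⊢ <;> omega
  · rintro ⟨T, κ⟩ hq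
    simp only [mem_filter, mem_sigma, mem_powerset, Fintype.mem_piFinset] at hq ⊢
    obtain ⟨⟨hT, h1, h2⟩, h3⟩ := hq
    refine Sigma.ext ?_ (heq_of_eq ?_)
    · ext v
      have := h1 v
      have h4 := @hT v
      by_cases hv : v ∈ U <;> by_cases hvT : v ∈ T <;> simp [hv, hvT] at this h4 ⊢ <;> omega
    · funext v
      have := h1 v
      have h4 := @hT v
      by_cases hv : v ∈ U <;> by_cases hvT : v ∈ T <;> simp [hv, hvT] at this h4 ⊢ <;> omega
  · intro κ hκ
    obtain ⟨h1, h2⟩ := mem_filter.1 hκ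
    rw [Fintype.mem_piFinset] at h1
    have hs : ∀ a ∈ U.filter (fun v => κ v = n), ∀ b ∈ U.filter (fun v => κ v = n), ¬ adj a b := by
      intro a ha b hb hab
      rw [mem_filter] at ha hb
      exact h2 a ha.1 b hb.1 hab (ha.2.trans hb.2.symm)
    rw [twist, stab, if_pos hs, mul_one, wt, ← Finset.prod_pow_eq_pow_sum,
      ← Finset.prod_sdiff (Finset.filter_subset (fun v => κ v = n) U), mul_comm]
    congr 1
    · refine Finset.prod_congr rfl fun v hv => ?_
      rw [(mem_filter.1 hv).2]
    · refine Finset.prod_congr rfl fun v hv => ?_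
      have h3 := h1 v
      simp only [mem_sdiff, mem_filter, not_and] at hv
      simp only [hv.1, if_true, mem_range] at h3
      have := hv.2 hv.1
      have h4 : min (κ v) n = κ v := min_eq_left (by omega)
      simp only [h4]

theorem Rec.colorSum {adj : V → V → Prop} (hadj : ∀ x y, adj x y → adj y x) (u : V → ℕ)
    (x : ℕ → R) (n : ℕ) :
    Rec (kernel adj) u (fun k => ∑ i ∈ range n, x i ^ k) (colorSum adj u x n) := by
  induction n with
  | zero =>
    rw [colorSum_zero]
    convert Rec.delta using 2
    simp
  | succ n ih =>
    rw [colorSum_succ]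
    convert (Rec.twist_stab hadj u (x n)).conv ih using 2
    rw [Finset.sum_range_succ, add_comm]
    rfl

end SetConv

/-! ### Elementary symmetric functions, power sums and the length specialization -/

namespace SymFun

open MvPolynomial
open Finset.HasAntidiagonal (antidiagonal)

variable {K : Type*} [Field K]

/-- The homomorphism that evaluates the variable `j` at the elementary symmetric function
`e_{j+1}`. -/
def ev (K : Type*) [Field K] : MvPolynomial ℕ K →ₐ[K] MvPowerSeries ℕ K :=
  aeval fun j => elem K (j + 1)

/-- The homomorphism that sends every `e_{j+1}` to the variable of `K[y]`. -/
def lengthHom (K : Type*) [Field K] : MvPolynomial ℕ K →ₐ[K] Polynomial K :=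
  aeval fun _ => Polynomial.X

/-- The restriction of a power series to the first `n` variables. -/
def proj (K : Type*) [Field K] (n : ℕ) : MvPowerSeries ℕ K →ₐ[K] MvPowerSeries (Fin n) K :=
  MvPowerSeries.killCompl Fin.valEmbedding

theorem proj_ext {f g : MvPowerSeries ℕ K} (h : ∀ n, proj K n f = proj K n g) : f = g := by
  classical
  ext m
  obtain ⟨n, hn⟩ := m.support.exists_nat_subset_range
  have hm : m ∈ Set.range (Finsupp.embDomain (Fin.valEmbedding (n := n))) := by
    rw [Finsupp.mem_range_embDomain_iff]
    intro i hi
    exact ⟨⟨i, Finset.mem_range.1 (hn hi)⟩, rfl⟩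
  obtain ⟨m', rfl⟩ := hm
  have := congrArg (MvPowerSeries.coeff m') (h n)
  simpa [proj, MvPowerSeries.coeff_killCompl] using this

theorem coeff_elem (k : ℕ) (m : ℕ →₀ ℕ) [Decidable ((∀ i, m i ≤ 1) ∧ m.degree = k)] :
    MvPowerSeries.coeff m (elem K k) = if (∀ i, m i ≤ 1) ∧ m.degree = k then 1 else 0 := by
  change elem K k m = _
  rw [elem]
  congr

theorem coeff_esymm {σ : Type*} [Fintype σ] (k : ℕ) (m : σ →₀ ℕ)
    [Decidable ((∀ i, m i ≤ 1) ∧ m.degree = k)] :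
    MvPolynomial.coeff m (esymm σ K k) = if (∀ i, m i ≤ 1) ∧ m.degree = k then 1 else 0 := by
  classical
  rw [esymm_eq_sum_monomial, coeff_sum]
  simp only [coeff_monomial]
  have key : ∀ t : Finset σ, (∑ i ∈ t, Finsupp.single i 1 : σ →₀ ℕ) = m ↔
      (∀ i, m i ≤ 1) ∧ t = m.support := by
    intro t
    have hval : ∀ i, (∑ i ∈ t, Finsupp.single i 1 : σ →₀ ℕ) i = if i ∈ t then 1 else 0 := by
      intro i
      simp [Finsupp.finsetSum_apply, Finsupp.single_apply]
    constructor
    · rintro rfl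
      refine ⟨fun i => ?_, ?_⟩
      · rw [hval]; split_ifs <;> simp
      · ext i
        rw [Finsupp.mem_support_iff, hval]
        simp
    · rintro ⟨h1, rfl⟩
      ext i
      rw [hval]
      have := h1 i
      by_cases h : m i = 0 <;> simp [h]
      omega
  simp only [key]
  by_cases h1 : ∀ i, m i ≤ 1
  · have hd : m.degree = m.support.card := by
      rw [Finsupp.degree_apply, Finset.card_eq_sum_ones]
      refine Finset.sum_congr rfl fun i hi => ?_
      have := h1 i
      have := Finsupp.mem_support_iff.1 hi
      omega
    simp [h1, Finset.mem_powersetCard, hd]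
  · simp [h1]

theorem proj_elem (n k : ℕ) :
    proj K n (elem K k) = ((esymm (Fin n) K k : MvPolynomial (Fin n) K) :
      MvPowerSeries (Fin n) K) := by
  classical
  ext m
  rw [proj, MvPowerSeries.coeff_killCompl, coeff_elem, MvPolynomial.coeff_coe, coeff_esymm]
  refine if_congr ?_ rfl rfl
  have h1 : (m.embDomain Fin.valEmbedding).degree = m.degree := by
    rw [Finsupp.degree_apply, Finsupp.degree_apply, Finsupp.support_embDomain, Finset.sum_map]
    simp only [Finsupp.embDomain_apply_self]
  rw [h1]
  refine and_congr ⟨fun h i => ?_, fun h i => ?_⟩ Iff.rfl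
  · have := h i
    rwa [show (i : ℕ) = Fin.valEmbedding i from rfl, Finsupp.embDomain_apply_self] at this
  · by_cases hi : i < n
    · have h2 := h ⟨i, hi⟩
      rw [← Finsupp.embDomain_apply_self Fin.valEmbedding m ⟨i, hi⟩] at h2
      exact h2
    · rw [Finsupp.embDomain_of_notMem_range]
      · simp
      · rintro ⟨j, rfl⟩
        exact hi j.2

theorem proj_ev_rename (n : ℕ) (q : MvPolynomial (Fin n) K) :
    proj K n (ev K (rename Fin.val q)) =
      (((esymmAlgHom (Fin n) K n q).val : MvPolynomial (Fin n) K) : MvPowerSeries (Fin n) K) := by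
  rw [esymmAlgHom_apply, ev, aeval_rename]
  change ((proj K n).comp (aeval _)) q =
    ((coeToMvPowerSeries.algHom K).comp (aeval fun i : Fin n => esymm (Fin n) K (i + 1))) q
  congr 1
  ext i : 1
  simp [proj_elem]

/-- A polynomial uses only finitely many of the `e_j`, and `e_1, …, e_n` are algebraically
independent already in `n` variables. -/
theorem ev_injective : Function.Injective (ev K) := by
  rw [injective_iff_map_eq_zero]
  intro q hq
  obtain ⟨n, hn⟩ := q.vars.exists_nat_subset_range
  obtain ⟨q', rfl⟩ := exists_rename_eq_of_vars_subset_range q (Fin.val : Fin n → ℕ)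
    Fin.val_injective (fun i hi => ⟨⟨i, Finset.mem_range.1 (hn hi)⟩, rfl⟩)
  have h := proj_ev_rename n q'
  rw [hq, map_zero] at h
  have h2 : (esymmAlgHom (Fin n) K n q').val = 0 := by
    apply MvPolynomial.coe_injective
    rw [← h, MvPolynomial.coe_zero]
  rw [ZeroMemClass.coe_eq_zero] at h2
  have h3 := esymmAlgHom_injective (σ := Fin n) K (by simp) (h2.trans (map_zero _).symm)
  rw [h3, map_zero]

/-- The polynomial that `ev` sends to `e_k`. -/
def elemVar (K : Type*) [Field K] (k : ℕ) : MvPolynomial ℕ K := if k = 0 then 1 else X (k - 1)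

theorem ev_elemVar {k : ℕ} (hk : 0 < k) : ev K (elemVar K k) = elem K k := by
  obtain ⟨k, rfl⟩ := Nat.exists_eq_succ_of_ne_zero hk.ne'
  simp [elemVar, ev]

theorem lengthHom_elemVar {k : ℕ} (hk : 0 < k) : lengthHom K (elemVar K k) = Polynomial.X := by
  obtain ⟨k, rfl⟩ := Nat.exists_eq_succ_of_ne_zero hk.ne'
  simp [elemVar, lengthHom]

theorem sum_geom_aux {R : Type*} [CommRing R] (z : R) (m : ℕ) :
    ∑ b ∈ Finset.range m, (1 - z) * (z ^ (b + 1) - 1) = z - z ^ (m + 1) - m * (1 - z) := by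
  induction m with
  | zero => simp
  | succ m ih =>
    rw [Finset.sum_range_succ, ih]
    push_cast
    ring

/-- Newton's recursion for the values `e_a ↦ 1 - z` (`a ≥ 1`) and `p_k ↦ (-z)^k - (-1)^k`. After the
signs are pulled out, the sum is geometric. -/
theorem newton_length {R : Type*} [CommRing R] (z : R) {k : ℕ} (hk : 0 < k) :
    (-z) ^ k - (-1) ^ k = (-1) ^ (k + 1) * k * (1 - z) -
      ∑ a ∈ antidiagonal k with a.1 ∈ Set.Ioo 0 k,
        (-1) ^ a.1 * (1 - z) * ((-z) ^ a.2 - (-1) ^ a.2) := by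
  obtain ⟨m, rfl⟩ := Nat.exists_eq_succ_of_ne_zero hk.ne'
  have h : ∑ a ∈ antidiagonal (m + 1) with a.1 ∈ Set.Ioo 0 (m + 1),
      (-1) ^ a.1 * (1 - z) * ((-z) ^ a.2 - (-1) ^ a.2) =
      (-1) ^ (m + 1) * ∑ b ∈ Finset.range m, (1 - z) * (z ^ (b + 1) - 1) := by
    rw [Finset.mul_sum, Finset.sum_filter, ← Finset.Nat.sum_antidiagonal_swap,
      Finset.Nat.sum_antidiagonal_eq_sum_range_succ_mk, Finset.sum_range_succ,
      Finset.sum_range_succ']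
    simp only [Prod.swap, Set.mem_Ioo]
    -- The two end terms of the antidiagonal are excluded by the filter.
    rw [if_neg (by simp), if_neg (by simp), add_zero, add_zero]
    refine Finset.sum_congr rfl fun b hb => ?_
    rw [Finset.mem_range] at hb
    rw [if_pos (by omega)]
    have e : (-1 : R) ^ (m + 1) = (-1) ^ (m + 1 - (b + 1)) * (-1) ^ (b + 1) := by
      rw [← pow_add]
      congr 1
      omega
    have e2 : ((-1 : R) ^ (b + 1)) * (-1) ^ (b + 1) = 1 := by
      rw [← mul_pow]; simp
    rw [e, neg_pow z]
    ring
  rw [Nat.succ_eq_add_one, h, sum_geom_aux, neg_pow z]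
  push_cast
  ring

/-- Power sums are polynomials in the elementary symmetric functions. -/
theorem exists_psum (k : ℕ) (hk : 0 < k) : ∃ P : MvPolynomial ℕ K,
    (∀ n, proj K n (ev K P) = ((psum (Fin n) K k : MvPolynomial (Fin n) K) :
      MvPowerSeries (Fin n) K)) ∧
    lengthHom K P = (-(1 - Polynomial.X)) ^ k - (-1) ^ k := by
  induction k using Nat.strong_induction_on with
  | _ k ih =>
    choose! P hP using ih
    refine ⟨(-1) ^ (k + 1) * k * elemVar K k -
      ∑ a ∈ antidiagonal k with a.1 ∈ Set.Ioo 0 k, (-1) ^ a.1 * elemVar K a.1 * P a.2,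
      fun n => ?_, ?_⟩
    · rw [psum_eq_mul_esymm_sub_sum _ _ k hk, ← coeToMvPowerSeries.ringHom_apply]
      simp only [map_sub, map_sum, map_mul, map_pow, map_neg, map_one, map_natCast]
      rw [ev_elemVar hk, proj_elem]
      refine congrArg₂ (· - ·) rfl (Finset.sum_congr rfl fun a ha => ?_)
      simp only [Finset.mem_filter, Finset.HasAntidiagonal.mem_antidiagonal, Set.mem_Ioo] at ha
      rw [ev_elemVar ha.2.1, proj_elem, (hP a.2 (by omega) (by omega)).1]
      rfl
    · rw [newton_length (1 - Polynomial.X : Polynomial K) hk]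
      simp only [map_sub, map_sum, map_mul, map_pow, map_neg, map_one, map_natCast]
      rw [lengthHom_elemVar hk, sub_sub_cancel]
      refine congrArg₂ (· - ·) rfl (Finset.sum_congr rfl fun a ha => ?_)
      simp only [Finset.mem_filter, Finset.HasAntidiagonal.mem_antidiagonal, Set.mem_Ioo] at ha
      rw [lengthHom_elemVar ha.2.1, (hP a.2 (by omega) (by omega)).2]

/-- The exponent vector of the monomial of a partition. -/
def partExp (p : IntPartition) : ℕ →₀ ℕ := Multiset.toFinsupp (p.2.parts.map Nat.pred)

theorem map_succ_pred_parts (p : IntPartition) :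
    (p.2.parts.map Nat.pred).map Nat.succ = p.2.parts := by
  rw [Multiset.map_map]
  conv_rhs => rw [← Multiset.map_id p.2.parts]
  refine Multiset.map_congr rfl fun i hi => ?_
  exact Nat.succ_pred_eq_of_pos (p.2.parts_pos hi)

theorem partExp_injective : Function.Injective partExp := by
  intro p q h
  have h1 : p.2.parts = q.2.parts := by
    rw [← map_succ_pred_parts p, ← map_succ_pred_parts q, Multiset.toFinsupp.injective h]
  obtain ⟨d, p⟩ := p
  obtain ⟨d', q⟩ := q
  simp only at h1
  have h2 : d = d' := by rw [← p.parts_sum, ← q.parts_sum, h1]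
  subst h2
  rw [Nat.Partition.ext h1]

theorem partExp_surjective : Function.Surjective partExp := by
  intro m
  refine ⟨⟨_, ⟨(Finsupp.toMultiset m).map Nat.succ, ?_, rfl⟩⟩, ?_⟩
  · intro i hi
    obtain ⟨j, -, rfl⟩ := Multiset.mem_map.1 hi
    exact Nat.succ_pos j
  · simp [partExp, Multiset.map_map]

/-- The polynomial in the elementary symmetric functions with given coefficients. -/
def ofCoeffs (c : IntPartition →₀ K) : MvPolynomial ℕ K :=
  c.sum fun p a => monomial (partExp p) a

theorem coeff_ofCoeffs (c : IntPartition →₀ K) (p : IntPartition) :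
    MvPolynomial.coeff (partExp p) (ofCoeffs c) = c p := by
  classical
  simp only [ofCoeffs, Finsupp.sum, coeff_sum, coeff_monomial, partExp_injective.eq_iff]
  simp +contextual [eq_comm]

theorem ofCoeffs_injective : Function.Injective (ofCoeffs (K := K)) := by
  intro c d h
  ext p
  rw [← coeff_ofCoeffs, h, coeff_ofCoeffs]

theorem ofCoeffs_surjective : Function.Surjective (ofCoeffs (K := K)) := by
  intro q
  induction q using MvPolynomial.induction_on' with
  | monomial m a =>
    obtain ⟨p, rfl⟩ := partExp_surjective m
    exact ⟨Finsupp.single p a, by simp [ofCoeffs]⟩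
  | add q r hq hr =>
    obtain ⟨c, rfl⟩ := hq
    obtain ⟨d, rfl⟩ := hr
    exact ⟨c + d, Finsupp.sum_add_index' (by simp) (by simp)⟩

/-- The variable `j` stands for `e_{j+1}`, so a part `i` is recorded at `i - 1` and has to be
shifted back. -/
theorem aeval_monomial_partExp {A : Type*} [CommRing A] [Algebra K A] (f : ℕ → A)
    (p : IntPartition) (a : K) :
    aeval (fun j => f (j + 1)) (monomial (partExp p) a) = a • (p.2.parts.map f).prod := by
  rw [aeval_monomial, Algebra.smul_def]
  congr 1
  conv_rhs => rw [← map_succ_pred_parts p]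
  rw [Multiset.map_map, partExp, Finsupp.prod, Multiset.toFinsupp_support,
    Finset.prod_multiset_map_count]
  simp

theorem isEExpansion_iff {f : MvPowerSeries ℕ K} {c : IntPartition →₀ K} :
    IsEExpansion f c ↔ f = ev K (ofCoeffs c) := by
  rw [IsEExpansion, ofCoeffs, Finsupp.sum, Finsupp.sum, map_sum]
  simp only [ev, aeval_monomial_partExp (elem K)]
  rfl

theorem existsUnique_isEExpansion (q : MvPolynomial ℕ K) : ∃! c, IsEExpansion (ev K q) c := by
  obtain ⟨c, rfl⟩ := ofCoeffs_surjective q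
  exact ⟨c, isEExpansion_iff.2 rfl, fun d hd =>
    (ofCoeffs_injective (ev_injective (isEExpansion_iff.1 hd))).symm⟩

/-- `lengthHom` sends the monomial of a partition to `X` to the power of its length. Injectivity of
`ev` identifies the chosen `e`-coefficients with those of `q`. -/
theorem sigma_ev (l : ℕ) (q : MvPolynomial ℕ K) :
    sigma l (ev K q) = (lengthHom K q).coeff l := by
  have h := (existsUnique_isEExpansion q).exists
  have hc : IsEExpansion (ev K q) (eCoeffs (ev K q)) := by
    rw [eCoeffs, dif_pos h]
    exact h.choose_spec
  rw [isEExpansion_iff] at hc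
  have hq := ev_injective hc
  rw [sigma]
  conv_rhs => rw [hq]
  rw [ofCoeffs, Finsupp.sum, Finsupp.sum, map_sum, Polynomial.finsetSum_coeff]
  refine Finset.sum_congr rfl fun p _ => ?_
  rw [lengthHom, aeval_monomial_partExp (fun _ => Polynomial.X)]
  simp [IntPartition.length, Polynomial.coeff_X_pow, eq_comm]

end SymFun

/-! ### The chromatic function in terms of elementary symmetric functions -/

namespace SetConv

section

variable {V R : Type*} [DecidableEq V] [CommRing R]

/-- Lifts the recursion from the symmetric functions in `n` variables, for all `n` together, to
polynomials in the `e_j`. -/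
theorem Rec.of_map {ι : Type*} {S : ι → Type*} [∀ i, CommRing (S i)] (φ : ∀ i, R →+* S i)
    (hφ : ∀ a b, (∀ i, φ i a = φ i b) → a = b) {c : V → Finset V → ℤ} (hc : ∀ v, c v ∅ = 0)
    {u : V → ℕ} {p : ℕ → R} {q : ∀ i, ℕ → S i}
    (hpq : ∀ i (U : Finset V), U.Nonempty → φ i (p (wt u U)) = q i (wt u U)) {f : Finset V → R}
    (hf : ∀ i, Rec c u (q i) (fun U => φ i (f U))) : Rec c u p f := by
  refine ⟨hφ _ _ fun i => (hf i).1.trans (map_one _).symm, fun v => funext fun U => hφ _ _ fun i => ?_⟩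
  have h := congrFun ((hf i).2 v) U
  rw [map_conv]
  refine Eq.trans ?_ (h.trans ?_)
  · simp [pt, apply_ite (φ i)]
  · refine Finset.sum_congr rfl fun T _ => ?_
    rcases T.eq_empty_or_nonempty with rfl | hne
    · simp [hc]
    · simp only [map_mul, map_intCast, hpq i T hne]

theorem twist_delta (u : V → ℕ) (x : R) : twist u x delta = (delta : Finset V → R) := by
  funext U
  by_cases h : U = ∅ <;> simp [twist, delta, h, wt]

end

open Finset MvPolynomial SymFun
open scoped Classical

variable {V : Type*} [Fintype V] {K : Type*} [Field K]

/-- Convolving `f` with the one-color function of `y` adds `y ^ k` to the power sums and leaves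
those of the single variable `x`. By uniqueness the result is the one-color function of `x`, and the
factor of `y` is then cancelled by its inverse. -/
theorem eq_conv_of_rec {R : Type*} [CommRing R] {adj : V → V → Prop}
    (hadj : ∀ x y, adj x y → adj y x) {u : V → ℕ} (hu : ∀ v, 0 < u v) {p : ℕ → R} (x y : R)
    (hp : ∀ k, 0 < k → p k = x ^ k - y ^ k) {f : Finset V → R} (hf : Rec (kernel adj) u p f) :
    f = conv (twist u x (stab adj)) (twist u y (sgnAcyc adj)) := by
  have h := Rec.unique (kernel_empty adj) (fun U hU => ?_) (hf.conv (Rec.twist_stab hadj u y))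
    (Rec.twist_stab hadj u x)
  · rw [← h, conv_assoc, twist_conv, conv_stab_sgnAcyc hadj, twist_delta, conv_delta]
  · have : 0 < wt u U := Finset.sum_pos (fun v _ => hu v) hU
    simp [hp _ this]

/-- This is `sum_acyc_prod_sinks` with `g v = -z ^ u v`; the signs of `T` and `U \ T` combine to a
global one. -/
theorem conv_twist_eq {R : Type*} [CommRing R] {adj : V → V → Prop}
    (hadj : ∀ x y, adj x y → adj y x) (u : V → ℕ) (z : R) (U : Finset V) :
    conv (twist u (-z) (stab adj)) (twist u (-1) (sgnAcyc adj)) U =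
      (-1) ^ (U.card + wt u U) * ∑ r ∈ acyc adj U, ∏ v ∈ sinks U r, (1 - z ^ u v) := by
  have h := sum_acyc_prod_sinks hadj (fun v => -(z ^ u v)) U
  simp only [← sub_eq_add_neg] at h
  rw [h, conv, conv, Finset.mul_sum]
  refine Finset.sum_congr rfl fun T hT => ?_
  have h1 : ∏ v ∈ T, -(z ^ u v) = (-1) ^ T.card * z ^ wt u T := by
    rw [Finset.prod_neg, wt, Finset.prod_pow_eq_pow_sum]
  have h2 : ((-1 : R) ^ T.card) * (-1) ^ T.card = 1 := by
    rw [← mul_pow]; simp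
  rw [h1, twist, twist, sgnAcyc, ← wt_add (mem_powerset.1 hT),
    ← Finset.card_sdiff_add_card_eq_card (mem_powerset.1 hT), neg_pow z, pow_add, pow_add, pow_add]
  linear_combination (-((-1) ^ wt u T * z ^ wt u T * stab adj T * ((-1) ^ wt u (U \ T) *
    ((-1) ^ (U \ T).card * ((acyc adj (U \ T)).card : R))))) * h2

/-- The chromatic symmetric function as a polynomial in the elementary symmetric functions. -/
theorem exists_colorSum_eq {adj : V → V → Prop} (hadj : ∀ x y, adj x y → adj y x) {u : V → ℕ}
    (hu : ∀ v, 0 < u v) (U : Finset V) : ∃ q : MvPolynomial ℕ K,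
      (∀ n, proj K n (ev K q) = proj K n (colorSum adj u MvPowerSeries.X n U)) ∧
      lengthHom K q = (-1) ^ (U.card + wt u U) *
        ∑ r ∈ acyc adj U, ∏ v ∈ sinks U r, (1 - (1 - Polynomial.X) ^ u v) := by
  -- The value `P 0` is arbitrary; it is harmless because nonempty sets have positive weight.
  choose! P hP using exists_psum (K := K)
  have hwt : ∀ U : Finset V, U.Nonempty → 0 < wt u U :=
    fun U hU => Finset.sum_pos (fun v _ => hu v) hU
  have hpsum : ∀ n k, proj K n (∑ i ∈ range n, (MvPowerSeries.X i : MvPowerSeries ℕ K) ^ k) =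
      ((psum (Fin n) K k : MvPolynomial (Fin n) K) : MvPowerSeries (Fin n) K) := by
    intro n k
    rw [Finset.sum_range, map_sum, ← coeToMvPowerSeries.ringHom_apply, psum, map_sum]
    refine Finset.sum_congr rfl fun i _ => ?_
    rw [map_pow, map_pow, coeToMvPowerSeries.ringHom_apply, MvPolynomial.coe_X]
    congr 1
    exact MvPowerSeries.killCompl_X (e := Fin.valEmbedding) i
  have hg : ∀ n, Rec (kernel adj) u
      (fun k => ((psum (Fin n) K k : MvPolynomial (Fin n) K) : MvPowerSeries (Fin n) K))
      (fun U => proj K n (colorSum adj u MvPowerSeries.X n U)) := by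
    intro n
    have h := (Rec.colorSum hadj u (MvPowerSeries.X : ℕ → MvPowerSeries ℕ K) n).map
      (proj K n).toRingHom
    refine cast ?_ h
    congr 1
    funext k
    exact hpsum n k
  let φ : ∀ n, MvPolynomial ℕ K →+* MvPowerSeries (Fin n) K :=
    fun n => (proj K n).toRingHom.comp (ev K).toRingHom
  have hφ : ∀ n (U : Finset V), U.Nonempty → φ n (P (wt u U)) =
      ((psum (Fin n) K (wt u U) : MvPolynomial (Fin n) K) : MvPowerSeries (Fin n) K) :=
    fun n U hU => (hP _ (hwt U hU)).1 n
  have hq : ∀ n U, φ n (solve (kernel adj) u P U) =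
      proj K n (colorSum adj u MvPowerSeries.X n U) :=
    fun n U => map_solve (φ n) (kernel_empty adj) (hφ n) (hg n) U
  -- In `n` variables the solution becomes the coloring sum, which obeys the recursion at every
  -- vertex. As the maps `φ n` jointly separate polynomials, the solution itself does so too and may
  -- be specialized by `lengthHom`.
  have hrec : Rec (kernel adj) u P (solve (kernel adj) u P) := by
    refine Rec.of_map φ (q := fun n k => ((psum (Fin n) K k : MvPolynomial (Fin n) K) :
      MvPowerSeries (Fin n) K)) (fun a b h => ev_injective (proj_ext h)) (kernel_empty adj) hφ fun n => ?_
    refine cast ?_ (hg n)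
    congr 1
    funext U
    exact (hq n U).symm
  refine ⟨solve (kernel adj) u P U, fun n => hq n U, ?_⟩
  -- Here `x = -(1 - X)` and `y = -1`, the two variables of the length specialization.
  rw [← conv_twist_eq hadj]
  exact congrFun (eq_conv_of_rec hadj hu _ _ (fun k hk => (hP k hk).2)
    (hrec.map (lengthHom K).toRingHom)) U

end SetConv

/-! ### From multigraphs to relations on vertices, and the sink count -/

namespace Graph

open Finset SetConv SymFun
open scoped Classical

variable {α β : Type*} {K : Type*} [Field K]

/-- Adjacency on the type of vertices. -/
def vadj (G : Graph α β) (x y : G.vertexSet) : Prop := G.Adj x y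

theorem vadj_symm (G : Graph α β) (x y : G.vertexSet) (h : G.vadj x y) : G.vadj y x := Adj.symm h

theorem colorExponent_eq (G : Graph α β) [Fintype G.vertexSet] (w : α → ℕ) (κ : G.vertexSet → ℕ) :
    G.colorExponent w κ = ∑ v, Finsupp.single (κ v) (w v) :=
  finsum_eq_sum_of_fintype _

theorem le_colorExponent (G : Graph α β) [Fintype G.vertexSet] (w : α → ℕ) (κ : G.vertexSet → ℕ)
    (v : G.vertexSet) : w v ≤ G.colorExponent w κ (κ v) := by
  rw [colorExponent_eq, Finsupp.finsetSum_apply]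
  refine le_trans ?_ (Finset.single_le_sum (fun _ _ => Nat.zero_le _) (Finset.mem_univ v))
  simp

theorem finite_colorExponent_eq (G : Graph α β) [Fintype G.vertexSet] {w : α → ℕ}
    (hw : ∀ v ∈ G.vertexSet, 0 < w v) (m : ℕ →₀ ℕ) :
    {κ : G.vertexSet → ℕ | G.colorExponent w κ = m}.Finite := by
  refine (Fintype.piFinset fun _ : G.vertexSet => m.support).finite_toSet.subset fun κ hκ => ?_
  simp only [Set.mem_ofPred_eq] at hκ
  simp only [mem_coe, Fintype.mem_piFinset, Finsupp.mem_support_iff]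
  intro v h
  have h1 := G.le_colorExponent w κ v
  rw [hκ, h] at h1
  have := hw v v.2
  omega

theorem coeff_chromaticSymm (G : Graph α β) [Fintype G.vertexSet] {w : α → ℕ}
    (hw : ∀ v ∈ G.vertexSet, 0 < w v) (m : ℕ →₀ ℕ) :
    MvPowerSeries.coeff m (G.chromaticSymm K w) =
      (((G.finite_colorExponent_eq hw m).toFinset.filter G.IsProperColoring).card : K) := by
  change ∑ᶠ (κ : G.vertexSet → ℕ) (_ : κ ∈ {κ | G.IsProperColoring κ ∧ G.colorExponent w κ = m}),
    (1 : K) = _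
  have : {κ | G.IsProperColoring κ ∧ G.colorExponent w κ = m} =
      ((G.finite_colorExponent_eq hw m).toFinset.filter G.IsProperColoring : Set _) := by
    ext κ
    simp [and_comm]
  rw [this, finsum_mem_coe_finset, Finset.sum_const, nsmul_one]

theorem isProperColoring_iff (G : Graph α β) (κ : G.vertexSet → ℕ) :
    G.IsProperColoring κ ↔ ∀ a b, G.vadj a b → κ a ≠ κ b :=
  ⟨fun h _ _ ⟨e, he⟩ => h e _ _ he, fun h e a b he => h a b ⟨e, he⟩⟩

theorem proj_chromaticSymm (G : Graph α β) [Fintype G.vertexSet] {w : α → ℕ}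
    (hw : ∀ v ∈ G.vertexSet, 0 < w v) (n : ℕ) :
    proj K n (G.chromaticSymm K w) =
      proj K n (colorSum G.vadj (fun v => w v) MvPowerSeries.X n univ) := by
  ext m
  rw [proj, MvPowerSeries.coeff_killCompl, MvPowerSeries.coeff_killCompl, coeff_chromaticSymm G hw,
    colorSum, map_sum]
  have hX : ∀ κ : G.vertexSet → ℕ,
      ∏ v, (MvPowerSeries.X (κ v) : MvPowerSeries ℕ K) ^ w v =
      MvPowerSeries.monomial (G.colorExponent w κ) 1 := by
    intro κ
    rw [colorExponent_eq]
    simp only [MvPowerSeries.X_pow_eq]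
    induction (univ : Finset G.vertexSet) using Finset.induction_on with
    | empty => simp
    | insert a s ha ih =>
      rw [Finset.prod_insert ha, Finset.sum_insert ha, ih, MvPowerSeries.monomial_mul_monomial,
        one_mul]
  simp only [hX, MvPowerSeries.coeff_monomial]
  rw [Finset.sum_boole]
  congr 2
  ext κ
  simp only [mem_filter, Set.Finite.mem_toFinset, Set.mem_ofPred_eq, Fintype.mem_piFinset, mem_univ,
    if_true, mem_range, isProperColoring_iff, true_implies]
  constructor
  · rintro ⟨h1, h2⟩
    refine ⟨⟨fun v => ?_, h2⟩, h1.symm⟩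
    -- A color `≥ n` would occur with positive exponent, but the monomial only involves variables
    -- below `n`.
    by_contra hn
    have h3 := G.le_colorExponent w κ v
    rw [h1, Finsupp.embDomain_of_notMem_range] at h3
    · have := hw v v.2
      omega
    · rintro ⟨j, hj⟩
      exact hn (hj ▸ j.2)
  · rintro ⟨⟨-, h2⟩, h1⟩
    exact ⟨h1.symm, h2⟩

/-- The relation on the vertices of an acyclic orientation. -/
def AcyclicOrientation.rel {G : Graph α β} (γ : G.AcyclicOrientation) (x y : G.vertexSet) : Prop :=
  ∃ e, γ.1 e = (x, y)

/-- If two orientations with the same relation directed an edge oppositely, both directions would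
lie in the relation and form a cycle. So parallel edges cause no overcounting when orientations are
replaced by relations. -/
theorem AcyclicOrientation.rel_injective {G : Graph α β} :
    Function.Injective (AcyclicOrientation.rel (G := G)) := by
  intro γ δ h
  refine Subtype.ext (funext fun e => ?_)
  have h1 := γ.2.1 e
  have h2 := δ.2.1 e
  rcases h1.eq_and_eq_or_eq_and_eq h2 with ⟨h3, h4⟩ | ⟨h3, h4⟩
  · exact Prod.ext (Subtype.ext h3) (Subtype.ext h4)
  · exfalso
    have h3' : (γ.1 e).1 = (δ.1 e).2 := Subtype.ext h3
    have h4' : (γ.1 e).2 = (δ.1 e).1 := Subtype.ext h4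
    have r1 : γ.rel (γ.1 e).1 (γ.1 e).2 := ⟨e, rfl⟩
    have r2 : γ.rel (γ.1 e).2 (γ.1 e).1 := by
      rw [h]
      exact ⟨e, by rw [h3', h4']⟩
    exact γ.2.2 _ (Relation.TransGen.trans (.single r1) (.single r2))

theorem AcyclicOrientation.rel_mem {G : Graph α β} [Fintype G.vertexSet]
    (γ : G.AcyclicOrientation) : γ.rel ∈ acyc G.vadj univ := by
  refine mem_acyc.2 ⟨?_, ?_, γ.2.2⟩
  · rintro x y ⟨e, he⟩
    refine ⟨mem_univ _, mem_univ _, e, ?_⟩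
    have := γ.2.1 e
    rwa [he] at this
  · rintro x - y - ⟨e, he⟩
    have h := γ.2.1 ⟨e, he.edge_mem⟩
    rcases h.eq_and_eq_or_eq_and_eq he with ⟨h3, h4⟩ | ⟨h3, h4⟩
    · exact .inl ⟨⟨e, he.edge_mem⟩, Prod.ext (Subtype.ext h3) (Subtype.ext h4)⟩
    · exact .inr ⟨⟨e, he.edge_mem⟩, Prod.ext (Subtype.ext h3) (Subtype.ext h4)⟩

theorem AcyclicOrientation.exists_rel_eq {G : Graph α β} [Fintype G.vertexSet]
    {r : G.vertexSet → G.vertexSet → Prop} (hr : r ∈ acyc G.vadj univ) :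
    ∃ γ : G.AcyclicOrientation, γ.rel = r := by
  obtain ⟨h1, h2, h3⟩ := mem_acyc.1 hr
  have key : ∀ e : G.edgeSet, ∃ q : G.vertexSet × G.vertexSet, G.IsLink e q.1 q.2 ∧ r q.1 q.2 := by
    rintro ⟨e, he⟩
    obtain ⟨x, y, hxy⟩ := exists_isLink_of_mem_edgeSet he
    rcases h2 ⟨x, hxy.left_mem⟩ (mem_univ _) ⟨y, hxy.right_mem⟩ (mem_univ _) ⟨e, hxy⟩ with h | h
    · exact ⟨(_, _), hxy, h⟩
    · exact ⟨(_, _), hxy.symm, h⟩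
  choose q hq1 hq2 using key
  have hle : ∀ x y, (∃ e, q e = (x, y)) → r x y := by
    rintro x y ⟨e, he⟩
    have := hq2 e
    rwa [he] at this
  refine ⟨⟨q, hq1, fun v hv => h3 v (transGen_restrict (T := ∅) (by simp)
    (fun x y h _ => hle x y h) hv (by simp))⟩, ?_⟩
  funext x y
  refine propext ⟨hle x y, fun h => ?_⟩
  obtain ⟨-, -, e, he⟩ := h1 x y h
  rcases (hq1 ⟨e, he.edge_mem⟩).eq_and_eq_or_eq_and_eq he with ⟨h4, h5⟩ | ⟨h4, h5⟩
  · exact ⟨⟨e, he.edge_mem⟩, Prod.ext (Subtype.ext h4) (Subtype.ext h5)⟩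
  · exfalso
    have h6 := hq2 ⟨e, he.edge_mem⟩
    have h7 : (q ⟨e, he.edge_mem⟩).1 = y := Subtype.ext h4
    have h8 : (q ⟨e, he.edge_mem⟩).2 = x := Subtype.ext h5
    rw [h7, h8] at h6
    exact h3 x (Relation.TransGen.trans (.single h) (.single h6))

instance (G : Graph α β) [Fintype G.vertexSet] : Finite G.AcyclicOrientation :=
  Finite.of_injective _ AcyclicOrientation.rel_injective

/-- In the expansion of `(1 - x) ^ n` over subsets the empty set cancels the `1`. The nonempty
subsets that remain are the possible values of `S` at a sink. -/
theorem one_sub_pow_eq {R : Type*} [CommRing R] (x : R) (n : ℕ) :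
    1 - (1 - x) ^ n = ∑ T : {T : Finset (Fin n) // T.Nonempty}, -(-x) ^ T.1.card := by
  have h : (1 - x) ^ n = ∑ T : Finset (Fin n), (-x) ^ T.card := by
    have := Finset.prod_one_add (s := (univ : Finset (Fin n))) (f := fun _ => -x)
    simp only [Finset.prod_const, card_univ, Fintype.card_fin, Finset.powerset_univ] at this
    rw [← this, sub_eq_add_neg]
  rw [h, ← Finset.sum_subtype (univ.filter fun T : Finset (Fin n) => T.Nonempty) (by simp)
    (fun T => -(-x) ^ T.card), ← Finset.sum_filter_add_sum_filter_not univ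
    (fun T : Finset (Fin n) => T.Nonempty), Finset.sum_neg_distrib]
  have : (univ.filter fun T : Finset (Fin n) => ¬ T.Nonempty) = {∅} := by
    ext T
    simp
  rw [this]
  simp

theorem AcyclicOrientation.coeff_prod_sinks {G : Graph α β} [Fintype G.vertexSet]
    (γ : G.AcyclicOrientation) (w : α → ℕ) [Fintype (γ.SinkMap w)] (l : ℕ) :
    (∏ v ∈ SetConv.sinks univ γ.rel, (1 - (1 - Polynomial.X : Polynomial K) ^ w v)).coeff l =
      ∑ S : γ.SinkMap w, if swt S = l then (-1) ^ (l - γ.sinks.ncard) else 0 := by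
  have hmem : ∀ v, v ∈ SetConv.sinks univ γ.rel ↔ v ∈ γ.sinks := by
    intro v
    simp only [mem_sinks, mem_univ, true_and, AcyclicOrientation.rel, AcyclicOrientation.sinks,
      Set.mem_ofPred_eq, not_exists]
    exact ⟨fun h e he => h (γ.1 e).2 e (Prod.ext he rfl), fun h y e he => h e (by rw [he])⟩
  rw [Finset.prod_subtype _ hmem]
  simp only [one_sub_pow_eq]
  rw [Finset.prod_univ_sum, Fintype.piFinset_univ, Polynomial.finsetSum_coeff]
  refine Finset.sum_bij' (fun S _ => S) (fun S _ => S)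
    (fun _ _ => mem_univ _) (fun _ _ => mem_univ _) (fun _ _ => rfl) (fun _ _ => rfl) ?_
  intro S _
  have hs : swt (w := w) S = ∑ v : γ.sinks, (S v).1.card := finsum_eq_sum_of_fintype _
  have hcard : γ.sinks.ncard = Fintype.card γ.sinks := by
    rw [← Nat.card_coe_set_eq, Nat.card_eq_fintype_card]
  have hle : Fintype.card γ.sinks ≤ swt (w := w) S := by
    rw [hs, ← Finset.card_univ, Finset.card_eq_sum_ones]
    exact Finset.sum_le_sum fun v _ => (S v).2.card_pos
  rw [Finset.prod_neg, Finset.prod_pow_eq_pow_sum, ← hs, Finset.card_univ, hcard,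
    neg_pow (Polynomial.X : Polynomial K), ← mul_assoc, ← pow_add]
  have hC : ((-1 : Polynomial K)) = Polynomial.C (-1) := by simp
  rw [hC, ← Polynomial.C_pow, Polynomial.coeff_C_mul, Polynomial.coeff_X_pow]
  by_cases h : swt (w := w) S = l
  · rw [if_pos h.symm, if_pos h, mul_one, ← h]
    -- Every sink contributes `-1` and `(-X)^{|S(v)|}`, so the sign exponent is `sink + swt`, which
    -- has the parity of `swt - sink`. The subtraction is not truncated, by `hle`.
    rw [show Fintype.card γ.sinks + swt (w := w) S =
      2 * Fintype.card γ.sinks + (swt (w := w) S - Fintype.card γ.sinks) by omega, pow_add, pow_mul]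
    simp
  · rw [if_neg (Ne.symm h), if_neg h, mul_zero]

theorem cast_sinkCount (G : Graph α β) [Fintype G.vertexSet] (w : α → ℕ) (l : ℕ) :
    ((G.sinkCount w l : ℤ) : K) = (∑ r ∈ acyc G.vadj univ, ∏ v ∈ SetConv.sinks univ r,
      (1 - (1 - Polynomial.X : Polynomial K) ^ w v)).coeff l := by
  let _ : Fintype G.AcyclicOrientation := Fintype.ofFinite _
  have hfin : ∀ γ : G.AcyclicOrientation, Finite (γ.SinkMap w) := fun γ => by
    unfold AcyclicOrientation.SinkMap
    infer_instance
  let _ : ∀ γ : G.AcyclicOrientation, Fintype (γ.SinkMap w) := fun γ => Fintype.ofFinite _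
  have hsum : ∑ r ∈ acyc G.vadj univ, ∏ v ∈ SetConv.sinks univ r,
      (1 - (1 - Polynomial.X : Polynomial K) ^ w v) = ∑ γ : G.AcyclicOrientation,
      ∏ v ∈ SetConv.sinks univ γ.rel, (1 - (1 - Polynomial.X : Polynomial K) ^ w v) := by
    symm
    refine Finset.sum_bij (fun γ _ => γ.rel) (fun γ _ => γ.rel_mem)
      (fun γ _ δ _ h => AcyclicOrientation.rel_injective h) (fun r hr => ?_) (fun _ _ => rfl)
    obtain ⟨γ, hγ⟩ := AcyclicOrientation.exists_rel_eq hr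
    exact ⟨γ, mem_univ _, hγ⟩
  rw [hsum, Polynomial.finsetSum_coeff, sinkCount, finsum_eq_sum_of_fintype, Fintype.sum_sigma]
  simp only [finsum_eq_if]
  push_cast
  refine Finset.sum_congr rfl fun γ _ => ?_
  rw [γ.coeff_prod_sinks]

theorem exists_chromaticSymm_eq_ev (G : Graph α β) (hV : G.vertexSet.Finite) {w : α → ℕ}
    (hw : ∀ v ∈ G.vertexSet, 0 < w v) : ∃ q : MvPolynomial ℕ K, G.chromaticSymm K w = ev K q ∧
      ∀ l, (lengthHom K q).coeff l =
        (((-1) ^ (G.vertexSet.ncard + G.totalWeight w) * G.sinkCount w l : ℤ) : K) := by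
  let _ : Fintype G.vertexSet := hV.fintype
  obtain ⟨q, hq1, hq2⟩ := exists_colorSum_eq (K := K) G.vadj_symm (u := fun v => w v)
    (fun v => hw v v.2) univ
  refine ⟨q, proj_ext fun n => by rw [hq1, proj_chromaticSymm G hw], fun l => ?_⟩
  have h1 : G.vertexSet.ncard = (univ : Finset G.vertexSet).card := by
    rw [← Nat.card_coe_set_eq, Nat.card_eq_fintype_card, card_univ]
  have h2 : G.totalWeight w = wt (fun v : G.vertexSet => w v) univ := by
    rw [totalWeight, ← finsum_set_coe_eq_finsum_mem, finsum_eq_sum_of_fintype, wt]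
  have hC : ((-1 : Polynomial K)) = Polynomial.C (-1) := by simp
  rw [hq2, h1, h2, hC, ← Polynomial.C_pow, Polynomial.coeff_C_mul]
  push_cast
  rw [cast_sinkCount]

end Graph

/-! ### Contractions and the Tutte symmetric function -/

namespace Graph

open Finset SetConv SymFun
open scoped Classical

variable {α β : Type*} {K : Type*} [Field K] {G : Graph α β} {A : Set β}

theorem mergeClass_eq_iff {u v : α} : G.mergeClass A v = G.mergeClass A u ↔
    Relation.ReflTransGen (G.restrict A).Adj v u := by
  have hsymm : ∀ {x y}, Relation.ReflTransGen (G.restrict A).Adj x y →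
      Relation.ReflTransGen (G.restrict A).Adj y x :=
    fun h => by
      induction h with
      | refl => exact .refl
      | tail _ h ih => exact .head (Adj.symm h) ih
  constructor
  · intro h
    have : u ∈ G.mergeClass A u := Relation.ReflTransGen.refl
    rwa [← h] at this
  · intro h
    ext x
    exact ⟨fun hx => (hsymm h).trans hx, fun hx => h.trans hx⟩

theorem mem_mergeClass_iff {u v : α} :
    u ∈ G.mergeClass A v ↔ G.mergeClass A u = G.mergeClass A v :=
  mergeClass_eq_iff.symm.trans eq_comm

theorem mergeClass_subset {v : α} (hv : v ∈ G.vertexSet) : G.mergeClass A v ⊆ G.vertexSet := by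
  intro u hu
  rcases Relation.ReflTransGen.cases_tail hu with rfl | ⟨x, -, e, he⟩
  · exact hv
  · exact he.right_mem

/-- The quotient map from the vertices of `G` to the vertices of `G/A`. -/
def contractMap (G : Graph α β) (A : Set β) (v : G.vertexSet) : (G.contract A).vertexSet :=
  ⟨G.mergeClass A v, v, v.2, rfl⟩

theorem contractMap_surjective : Function.Surjective (G.contractMap A) := by
  rintro ⟨-, v, hv, rfl⟩
  exact ⟨⟨v, hv⟩, rfl⟩

theorem contractMap_eq_iff {u v : G.vertexSet} : G.contractMap A u = G.contractMap A v ↔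
    Relation.ReflTransGen (G.restrict A).Adj u v := by
  exact Subtype.ext_iff.trans mergeClass_eq_iff

theorem finite_vertexSet_contract (hV : G.vertexSet.Finite) (A : Set β) :
    (G.contract A).vertexSet.Finite := hV.image _

theorem contractWeight_eq [Fintype G.vertexSet] (w : α → ℕ) (C : (G.contract A).vertexSet) :
    contractWeight w C.1 = ∑ v ∈ univ.filter (fun v => G.contractMap A v = C), w v := by
  obtain ⟨v, rfl⟩ := contractMap_surjective C
  rw [contractWeight]
  have : (G.contractMap A v).1 = ((univ.filter fun u => G.contractMap A u = G.contractMap A v).map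
      (Function.Embedding.subtype _) : Set α) := by
    ext u
    simp only [coe_map, Function.Embedding.coe_subtype, Set.mem_image, mem_coe, mem_filter,
      mem_univ, true_and]
    constructor
    · intro hu
      exact ⟨⟨u, mergeClass_subset v.2 hu⟩, Subtype.ext (mem_mergeClass_iff.1 hu), rfl⟩
    · rintro ⟨u, hu, rfl⟩
      exact mem_mergeClass_iff.2 (congrArg Subtype.val hu)
  rw [this, finsum_mem_coe_finset, Finset.sum_map]
  rfl

theorem contractWeight_pos [Fintype G.vertexSet] {w : α → ℕ} (hw : ∀ v ∈ G.vertexSet, 0 < w v) :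
    ∀ C ∈ (G.contract A).vertexSet, 0 < contractWeight w C := by
  intro C hC
  have h := contractWeight_eq (A := A) w ⟨C, hC⟩
  simp only at h
  obtain ⟨v, hv⟩ := contractMap_surjective (⟨C, hC⟩ : (G.contract A).vertexSet)
  rw [h]
  exact Finset.sum_pos (fun v _ => hw v v.2) ⟨v, by simp [hv]⟩

theorem totalWeight_eq (G : Graph α β) [Fintype G.vertexSet] (w : α → ℕ) :
    G.totalWeight w = ∑ v : G.vertexSet, w v := by
  rw [totalWeight, ← finsum_set_coe_eq_finsum_mem, finsum_eq_sum_of_fintype]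

theorem totalWeight_contract [Fintype G.vertexSet] [Fintype (G.contract A).vertexSet]
    (w : α → ℕ) : (G.contract A).totalWeight (contractWeight w) = G.totalWeight w := by
  rw [totalWeight_eq, totalWeight_eq]
  simp only [contractWeight_eq]
  exact Finset.sum_fiberwise _ _ _

theorem colorExponent_contract [Fintype G.vertexSet] [Fintype (G.contract A).vertexSet]
    (w : α → ℕ) (κ : (G.contract A).vertexSet → ℕ) :
    (G.contract A).colorExponent (contractWeight w) κ =
      G.colorExponent w (κ ∘ G.contractMap A) := by
  rw [colorExponent_eq, colorExponent_eq, ← Finset.sum_fiberwise univ (G.contractMap A)]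
  refine Finset.sum_congr rfl fun C _ => ?_
  rw [contractWeight_eq, Finsupp.single_finsetSum]
  refine Finset.sum_congr rfl fun v hv => ?_
  rw [Function.comp_apply, (mem_filter.1 hv).2]

/-- The set of edges whose endpoints receive the same color. -/
def monoSet (G : Graph α β) (κ : G.vertexSet → ℕ) : Set β :=
  {e : β | ∃ x y : G.vertexSet, G.IsLink e x y ∧ κ x = κ y}

theorem monoSet_subset (κ : G.vertexSet → ℕ) : G.monoSet κ ⊆ G.edgeSet := by
  rintro e ⟨x, y, h, -⟩
  exact h.edge_mem

theorem mem_monoSet_iff {κ : G.vertexSet → ℕ} {e : β} {x y : G.vertexSet} (h : G.IsLink e x y) :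
    e ∈ G.monoSet κ ↔ κ x = κ y := by
  refine ⟨?_, fun hκ => ⟨x, y, h, hκ⟩⟩
  rintro ⟨a, b, hab, hκ⟩
  rcases h.eq_and_eq_or_eq_and_eq hab with ⟨h1, h2⟩ | ⟨h1, h2⟩
  · rw [Subtype.ext h1, Subtype.ext h2, hκ]
  · rw [Subtype.ext h1, Subtype.ext h2, hκ]

theorem isProperColoring_iff_monoSet (κ : G.vertexSet → ℕ) :
    G.IsProperColoring κ ↔ G.monoSet κ = ∅ := by
  rw [Set.eq_empty_iff_forall_notMem]
  constructor
  · rintro h e ⟨x, y, hxy, hκ⟩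
    exact h e x y hxy hκ
  · intro h e x y hxy hκ
    exact h e ⟨x, y, hxy, hκ⟩

theorem isLink_contract {e : β} {C D : (G.contract A).vertexSet} :
    (G.contract A).IsLink e C D ↔ ∃ x y : G.vertexSet, G.IsLink e x y ∧ e ∉ A ∧
      G.contractMap A x = C ∧ G.contractMap A y = D := by
  constructor
  · rintro ⟨x, y, ⟨h, hA⟩, hx, hy⟩
    exact ⟨⟨x, h.left_mem⟩, ⟨y, h.right_mem⟩, h, hA, Subtype.ext hx, Subtype.ext hy⟩
  · rintro ⟨x, y, h, hA, rfl, rfl⟩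
    exact ⟨x, y, ⟨h, hA⟩, rfl, rfl⟩

theorem eq_of_monoSet_eq {κ : G.vertexSet → ℕ} (h : A ⊆ G.monoSet κ) {u v : G.vertexSet}
    (huv : G.contractMap A u = G.contractMap A v) : κ u = κ v := by
  rw [contractMap_eq_iff] at huv
  obtain ⟨u, hu⟩ := u
  obtain ⟨v, hv⟩ := v
  simp only at huv
  induction huv with
  | refl => rfl
  | tail _ hbc ih =>
    obtain ⟨e, heA, he⟩ := hbc
    rw [ih he.left_mem]
    exact (mem_monoSet_iff (x := ⟨_, he.left_mem⟩) (y := ⟨_, hv⟩) he).1 (h heA)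

/-- The edges of `A` are monochromatic for any pulled-back coloring, as their endpoints are merged.
Properness on `G/A` says that no other edge is. -/
theorem isProperColoring_contract (hA : A ⊆ G.edgeSet) (κ : (G.contract A).vertexSet → ℕ) :
    (G.contract A).IsProperColoring κ ↔ G.monoSet (κ ∘ G.contractMap A) = A := by
  constructor
  · intro h
    ext e
    constructor
    · rintro ⟨x, y, hxy, hκ⟩
      by_contra he
      exact h e _ _ (isLink_contract.2 ⟨x, y, hxy, he, rfl, rfl⟩) hκ
    · intro he
      obtain ⟨x, y, hxy⟩ := exists_isLink_of_mem_edgeSet (hA he)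
      refine ⟨⟨x, hxy.left_mem⟩, ⟨y, hxy.right_mem⟩, hxy, congrArg κ ?_⟩
      exact contractMap_eq_iff.2 (.single ⟨e, he, hxy⟩)
  · intro h e C D hCD hκ
    obtain ⟨x, y, hxy, he, rfl, rfl⟩ := isLink_contract.1 hCD
    rw [← h] at he
    exact he ⟨x, y, hxy, hκ⟩

/-- Pulling back along the quotient map preserves the monomial, since weights add over merged
vertices, and matches the proper colorings of `G/A` with the colorings of `G` whose monochromatic
set is `A`. -/
theorem coeff_chromaticSymm_contract [Fintype G.vertexSet] {w : α → ℕ}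
    (hw : ∀ v ∈ G.vertexSet, 0 < w v) (hA : A ⊆ G.edgeSet) (m : ℕ →₀ ℕ) :
    MvPowerSeries.coeff m ((G.contract A).chromaticSymm K (contractWeight w)) =
      (((G.finite_colorExponent_eq hw m).toFinset.filter fun κ => G.monoSet κ = A).card : K) := by
  let _ : Fintype (G.contract A).vertexSet :=
    (finite_vertexSet_contract (Set.toFinite _) A).fintype
  rw [coeff_chromaticSymm _ (contractWeight_pos hw)]
  congr 1
  refine Finset.card_bij (fun κ _ => κ ∘ G.contractMap A) ?_ ?_ ?_
  · intro κ hκ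
    simp only [mem_filter, Set.Finite.mem_toFinset, Set.mem_ofPred_eq] at hκ ⊢
    exact ⟨by rw [← colorExponent_contract, hκ.1], (isProperColoring_contract hA κ).1 hκ.2⟩
  · intro κ _ κ' _ h
    exact contractMap_surjective.injective_comp_right h
  · intro κ hκ
    simp only [mem_filter, Set.Finite.mem_toFinset, Set.mem_ofPred_eq] at hκ ⊢
    -- A coloring that is monochromatic on `A` is constant on the merged classes, so any section of
    -- the quotient map gives the coloring of `G/A`.
    have hfac : (κ ∘ Function.surjInv contractMap_surjective) ∘ G.contractMap A = κ := by
      funext v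
      exact eq_of_monoSet_eq hκ.2.ge (Function.surjInv_eq contractMap_surjective _)
    exact ⟨_, ⟨by rw [colorExponent_contract, hfac, hκ.1],
      (isProperColoring_contract hA _).2 (by rw [hfac, hκ.2])⟩, hfac⟩

theorem coeff_tutteSymm [Fintype G.vertexSet] {w : α → ℕ} (hw : ∀ v ∈ G.vertexSet, 0 < w v)
    (m : ℕ →₀ ℕ) : MvPowerSeries.coeff m (G.tutteSymm K w) =
      ∑ κ ∈ (G.finite_colorExponent_eq hw m).toFinset,
        (1 + Polynomial.X) ^ (G.monoSet κ).ncard := by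
  change ∑ᶠ (κ : G.vertexSet → ℕ) (_ : κ ∈ {κ | G.colorExponent w κ = m}),
    (1 + Polynomial.X : Polynomial K) ^ (G.monoSet κ).ncard = _
  rw [finsum_mem_eq_finite_toFinset_sum _ (G.finite_colorExponent_eq hw m)]

theorem coeff_coeffOneAddT_tutteSymm [Fintype G.vertexSet] {w : α → ℕ}
    (hw : ∀ v ∈ G.vertexSet, 0 < w v) (k : ℕ) (m : ℕ →₀ ℕ) :
    MvPowerSeries.coeff m (coeffOneAddT k (G.tutteSymm K w)) =
      (((G.finite_colorExponent_eq hw m).toFinset.filter fun κ => (G.monoSet κ).ncard = k).card :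
        K) := by
  change (Polynomial.taylor (-1) (MvPowerSeries.coeff m (G.tutteSymm K w))).coeff k = _
  rw [coeff_tutteSymm hw, map_sum, Polynomial.finsetSum_coeff, ← Finset.sum_boole]
  refine Finset.sum_congr rfl fun κ _ => ?_
  -- The Taylor shift at `-1` substitutes `X - 1` for `X`, which turns powers of `1 + X` into powers
  -- of `X`.
  have h : Polynomial.taylor (-1 : K) (1 + Polynomial.X) = Polynomial.X := by
    rw [map_add, Polynomial.taylor_one, Polynomial.taylor_X]
    simp
  rw [Polynomial.taylor_pow, h, Polynomial.coeff_X_pow]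
  simp only [eq_comm]

theorem finite_subsets (hE : G.edgeSet.Finite) (k : ℕ) :
    {A : Set β | A ⊆ G.edgeSet ∧ A.ncard = k}.Finite :=
  hE.finite_subsets.subset fun _ h => h.1

/-- The coefficient of `(1+t)^k` is the sum of the chromatic symmetric functions of the
contractions of `k` edges. -/
theorem coeffOneAddT_tutteSymm (hV : G.vertexSet.Finite) (hE : G.edgeSet.Finite) {w : α → ℕ}
    (hw : ∀ v ∈ G.vertexSet, 0 < w v) (k : ℕ) :
    coeffOneAddT k (G.tutteSymm K w) = ∑ A ∈ (finite_subsets hE k).toFinset,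
      (G.contract A).chromaticSymm K (contractWeight w) := by
  let _ : Fintype G.vertexSet := hV.fintype
  ext m
  rw [coeff_coeffOneAddT_tutteSymm hw, map_sum]
  have : ∀ A ∈ (finite_subsets hE k).toFinset,
      MvPowerSeries.coeff m ((G.contract A).chromaticSymm K (contractWeight w)) =
      (((G.finite_colorExponent_eq hw m).toFinset.filter fun κ => G.monoSet κ = A).card : K) :=
    fun A hA => coeff_chromaticSymm_contract hw ((finite_subsets hE k).mem_toFinset.1 hA).1 m
  rw [Finset.sum_congr rfl this, ← Nat.cast_sum,
    Finset.card_eq_sum_card_fiberwise (f := G.monoSet) (t := (finite_subsets hE k).toFinset)]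
  · congr 1
    refine Finset.sum_congr rfl fun A hA => ?_
    rw [Finset.filter_filter]
    congr 1
    refine Finset.filter_congr fun κ _ => ⟨fun h => h.2, fun h => ⟨?_, h⟩⟩
    rw [h]
    exact ((finite_subsets hE k).mem_toFinset.1 hA).2
  · intro κ hκ
    simp only [coe_filter, Set.mem_ofPred_eq] at hκ
    simpa using ⟨monoSet_subset κ, hκ.2⟩

theorem chromaticSymm_eq_coeffOneAddT (hV : G.vertexSet.Finite) (hE : G.edgeSet.Finite)
    {w : α → ℕ} (hw : ∀ v ∈ G.vertexSet, 0 < w v) :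
    G.chromaticSymm K w = coeffOneAddT 0 (G.tutteSymm K w) := by
  let _ : Fintype G.vertexSet := hV.fintype
  ext m
  rw [coeff_coeffOneAddT_tutteSymm hw, coeff_chromaticSymm G hw]
  congr 2
  refine Finset.filter_congr fun κ _ => ?_
  rw [isProperColoring_iff_monoSet, Set.ncard_eq_zero (hE.subset (monoSet_subset κ))]

theorem map_eval_eq_coeffOneAddT (F : MvPowerSeries ℕ (Polynomial K)) :
    MvPowerSeries.map (Polynomial.evalRingHom (-1)) F = coeffOneAddT 0 F := by
  ext m
  rw [MvPowerSeries.coeff_map]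
  change _ = (Polynomial.taylor (-1) (MvPowerSeries.coeff m F)).coeff 0
  rw [Polynomial.taylor_coeff_zero, Polynomial.coe_evalRingHom]

theorem ncard_vertexSet_contract_empty (G : Graph α β) :
    (G.contract ∅).vertexSet.ncard = G.vertexSet.ncard := by
  refine Set.ncard_image_of_injective _ fun u v h => ?_
  rw [mergeClass_eq_iff] at h
  rcases Relation.ReflTransGen.cases_tail h with h | ⟨x, -, e, he, -⟩
  · exact h.symm
  · exact he.elim

theorem coeffOneAddT_tutteSymm_expansion (hV : G.vertexSet.Finite) (hE : G.edgeSet.Finite)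
    {w : α → ℕ} (hw : ∀ v ∈ G.vertexSet, 0 < w v) (k : ℕ) :
    (∃! c, IsEExpansion (coeffOneAddT k (G.tutteSymm K w)) c) ∧
    ∀ l, sigma l (coeffOneAddT k (G.tutteSymm K w)) =
      ((∑ᶠ (A : Set β) (_ : A ⊆ G.edgeSet ∧ A.ncard = k),
        (-1) ^ ((G.contract A).vertexSet.ncard + G.totalWeight w) *
          (G.contract A).sinkCount (contractWeight w) l : ℤ) : K) := by
  let _ : Fintype G.vertexSet := hV.fintype
  choose q hq1 hq2 using fun A : Set β => exists_chromaticSymm_eq_ev (K := K) (G.contract A)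
    (finite_vertexSet_contract hV A) (contractWeight_pos hw)
  have h : coeffOneAddT k (G.tutteSymm K w) =
      ev K (∑ A ∈ (finite_subsets hE k).toFinset, q A) := by
    rw [coeffOneAddT_tutteSymm hV hE hw, map_sum]
    exact Finset.sum_congr rfl fun A _ => hq1 A
  rw [h]
  refine ⟨existsUnique_isEExpansion _, fun l => ?_⟩
  have h2 := finsum_mem_eq_finite_toFinset_sum (fun A : Set β =>
    (-1) ^ ((G.contract A).vertexSet.ncard + G.totalWeight w) *
      (G.contract A).sinkCount (contractWeight w) l) (finite_subsets hE k)
  simp only [Set.mem_ofPred_eq] at h2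
  rw [sigma_ev, h2, map_sum, Polynomial.finsetSum_coeff, Int.cast_sum]
  refine Finset.sum_congr rfl fun A _ => ?_
  let _ : Fintype (G.contract A).vertexSet := (finite_vertexSet_contract hV A).fintype
  rw [hq2, totalWeight_contract]

theorem sum_alternating_choose (k : ℕ) (x : ℤ) :
    ∑ b ∈ Finset.range (k + 1), (-1) ^ (k - b) * (k.choose b : ℤ) * x = if k = 0 then x else 0 := by
  have h := add_pow (1 : ℤ) (-1) k
  simp only [one_pow, one_mul] at h
  rw [← Finset.sum_mul, ← h]
  split_ifs with hk <;> simp [hk]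

end Graph

end

theorem corollary4 {K : Type*} [Field K] [CharZero K] {α β : Type*}
    (G : Graph α β) (hV : G.vertexSet.Finite) (hE : G.edgeSet.Finite)
    (w : α → ℕ) (hw : ∀ v ∈ G.vertexSet, 0 < w v) :
    (∀ k l : ℕ,
      (∃! c, SymFun.IsEExpansion (SymFun.coeffOneAddT k (G.tutteSymm K w)) c) ∧
      SymFun.sigma l (SymFun.coeffOneAddT k (G.tutteSymm K w)) =
        ((∑ᶠ (A : Set β) (_ : A ⊆ G.edgeSet ∧ A.ncard = k),
          (-1) ^ ((G.contract A).vertexSet.ncard + G.totalWeight w) *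
            (G.contract A).sinkCount (Graph.contractWeight w) l : ℤ) : K)) ∧
    MvPowerSeries.map (Polynomial.evalRingHom (-1)) (G.tutteSymm K w) = G.chromaticSymm K w ∧
    (∀ l : ℕ,
      (∃! c, SymFun.IsEExpansion (G.chromaticSymm K w) c) ∧
      SymFun.sigma l (G.chromaticSymm K w) =
        (((-1) ^ (G.vertexSet.ncard + G.totalWeight w) *
          ∑ k ∈ Finset.range (G.edgeSet.ncard + 1), ∑ b ∈ Finset.range (k + 1),
            (-1) ^ (k - b) * (k.choose b : ℤ) *
              ∑ᶠ (A : Set β) (_ : A ⊆ G.edgeSet ∧ A.ncard = k),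
                (G.contract A).sinkCount (Graph.contractWeight w) l : ℤ) : K)) := by
  have hchrom := Graph.chromaticSymm_eq_coeffOneAddT (K := K) hV hE hw
  refine ⟨fun k l => ⟨(Graph.coeffOneAddT_tutteSymm_expansion hV hE hw k).1,
    (Graph.coeffOneAddT_tutteSymm_expansion hV hE hw k).2 l⟩, ?_, fun l => ?_⟩
  · rw [Graph.map_eval_eq_coeffOneAddT, hchrom]
  · rw [hchrom]
    refine ⟨(Graph.coeffOneAddT_tutteSymm_expansion hV hE hw 0).1, ?_⟩
    rw [(Graph.coeffOneAddT_tutteSymm_expansion hV hE hw 0).2 l]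
    -- The inner sum over `b` is `(1 - 1)^k` times the sum over `A`, so only `k = 0`, that is `A =
    -- ∅`, remains; `G/∅` has as many vertices as `G`.
    simp only [Graph.sum_alternating_choose]
    rw [Finset.sum_ite_eq' (Finset.range (G.edgeSet.ncard + 1)) 0, if_pos (by simp)]
    have h : {A : Set β | A ⊆ G.edgeSet ∧ A.ncard = 0} = {∅} := by
      ext A
      simp only [Set.mem_ofPred_eq, Set.mem_singleton_iff]
      constructor
      · rintro ⟨hA, h0⟩
        exact (Set.ncard_eq_zero (hE.subset hA)).1 h0
      · rintro rfl
        simp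
    have hsum : ∀ f : Set β → ℤ, ∑ᶠ (A : Set β) (_ : A ⊆ G.edgeSet ∧ A.ncard = 0), f A = f ∅ := by
      intro f
      change ∑ᶠ A ∈ {A : Set β | A ⊆ G.edgeSet ∧ A.ncard = 0}, f A = _
      rw [h, finsum_mem_singleton]
    rw [hsum, hsum, G.ncard_vertexSet_contract_empty]
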